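/- Let $\tau_E:E\to M$ be a Lie algebroid of rank $n$ over a smooth (Hausdorff) manifold $M$ of dimension $m$, with anchor $\rho$ and bracket $[\![\cdot,\cdot]\!]$. Let $\mathcal T^{\tau_E}E=\{(b,v)\in E\times TE:\rho(b)=T\tau_E(v)\}\to E$ be the $E$-tangent bundle to $E$, and $E^{(2)}=\{v\in T_eE:\ e\in E,\ \rho(e)=T_e\tau_E(v)\}$ the set of admissible elements. A chart $(x^i)$ of $M$ together with a local basis $\{e_A\}$ of sections of $E$ induces coordinates $(x^i,y^A)$ on $E$, $(x^i,y^A,z^A)$ on $E^{(2)}$ (where $z^A=\dot y^A$), and $(x^i,y^A,p_A,\bar p_A,z^A)$ on $W_0=E^{(2)}\times_E(\mathcal T^{\tau_E}E)^*$. Let $\nu:W_0\to E$ and $\pi_2:W_0\to(\mathcal T^{\tau_E}E)^*$ be the projections, let $\rho^\nu$ be the anchor of the prolongation Lie algebroid $\mathcal T^{\nu}\mathcal T^{\tau_E}E\to W_0$, and let $\Omega_{W_0}=(\mathcal T\pi_2,\pi_2)^*(-d\lambda)$, where $\lambda$ is the Liouville section of the prolongation of $\mathcal T^{\tau_E}E$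 over $(\mathcal T^{\tau_E}E)^*$. Let $L:E^{(2)}\to\mathbb R$ be smooth and let $\mathcal M\subset E^{(2)}$ be an embedded submanifold of codimension $\bar m$ such that $\mathcal M\to E$ is a surjective submersion. Locally $\mathcal M=\{\Phi^\alpha(x,y,z)=0,\ \alpha=1,\dots,\bar m\}$, with $\Phi^\alpha$ smooth and $(\partial\Phi^\alpha/\partial z^B)$ of rank $\bar m$ along $\mathcal M$. The first constraint submanifold $\overline W_1\subset W_0$ is locally the set of points for which there are multipliers $\lambda_1,\dots,\lambda_{\bar m}\in\mathbb R$ such that $$\bar p_A-\frac{\partial L}{\partial z^A}+\lambda_\alpha\frac{\partial\Phi^\alpha}{\partial z^A}=0\quad(A=1,\dots,n),\qquad \Phi^\alpha(x,y,z)=0\quad(\alpha=1,\dots,\bar m).$$ Let $\Omega_{\overline W_1}$ be the pullback of $\Omega_{W_0}$ to the Lie algebroid $(\rho^\nu)^{-1}(T\overline W_1)\to\overline W_1$. Then $\Omega_{\overline W_1}$ is a symplectic section (nondegenerate on every fibre, and closed for the Lie algebroid differential) if and only if, in every system of such local coordinates and constraint functions, the matrix $$\begin{pmatrix}\dfrac{\partial^2L}{\partial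 z^A\partial z^B}+\lambda_\alpha\dfrac{\partial^2\Phi^\alpha}{\partial z^A\partial z^B}&\dfrac{\partial\Phi^\alpha}{\partial z^A}\\[2mm]\dfrac{\partial\Phi^\alpha}{\partial z^B}&0\end{pmatrix}$$ is nondegenerate at all points of $\overline W_1$, with the corresponding multipliers $\lambda_\alpha$. Moreover, over each single local coordinate domain with constraint functions, $\Omega_{\overline W_1}$ is symplectic there if and only if this matrix is nondegenerate at all points of $\overline W_1$ there. -/

import Mathlib

open scoped Manifold ContDiff Bundle Matrix
open Bundle

noncomputable section

/-! ## Lie algebroids -/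

/-- A Lie algebroid structure on a smooth real vector bundle `E → M` of rank `n` over a smooth
manifold `M` of dimension `m`: a smooth vector bundle morphism `ρ : E → TM` (the anchor) and an
`ℝ`-Lie bracket on the space of global smooth sections, related by the Leibniz rule
`[X, f Y] = f [X, Y] + ρ(X)(f) Y`. -/
structure LieAlgebroid {m n : ℕ} {M : Type*} [TopologicalSpace M]
    [ChartedSpace (EuclideanSpace ℝ (Fin m)) M] [IsManifold (𝓡 m) ∞ M] (E : M → Type*)
    [TopologicalSpace (TotalSpace (EuclideanSpace ℝ (Fin n)) E)]
    [∀ x, AddCommGroup (E x)] [∀ x, Module ℝ (E x)] [∀ x, TopologicalSpace (E x)]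
    [FiberBundle (EuclideanSpace ℝ (Fin n)) E] [VectorBundle ℝ (EuclideanSpace ℝ (Fin n)) E] where
  /-- the anchor map -/
  anchor : ∀ x : M, E x →ₗ[ℝ] TangentSpace (𝓡 m) x
  /-- the anchor is a smooth map `E → TM` -/
  contMDiff_anchor :
    ContMDiff ((𝓡 m).prod 𝓘(ℝ, EuclideanSpace ℝ (Fin n))) (𝓡 m).tangent ∞
      (fun e : TotalSpace (EuclideanSpace ℝ (Fin n)) E =>
        (⟨e.proj, anchor e.proj e.snd⟩ : TangentBundle (𝓡 m) M))
  /-- the bracket of sections -/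
  bracket : Cₛ^∞⟮𝓡 m; EuclideanSpace ℝ (Fin n), E⟯ →ₗ[ℝ]
    Cₛ^∞⟮𝓡 m; EuclideanSpace ℝ (Fin n), E⟯ →ₗ[ℝ] Cₛ^∞⟮𝓡 m; EuclideanSpace ℝ (Fin n), E⟯
  bracket_self : ∀ X, bracket X X = 0
  jacobi : ∀ X Y Z,
    bracket X (bracket Y Z) + bracket Z (bracket X Y) + bracket Y (bracket Z X) = 0
  /-- the Leibniz rule; `Z` is the section `f Y` -/
  leibniz : ∀ (f : M → ℝ), ContMDiff (𝓡 m) 𝓘(ℝ, ℝ) ∞ f →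
    ∀ X Y Z : Cₛ^∞⟮𝓡 m; EuclideanSpace ℝ (Fin n), E⟯, (∀ x, Z x = f x • Y x) →
      ∀ x, bracket X Z x = f x • bracket X Y x +
        (show ℝ from mfderiv (𝓡 m) 𝓘(ℝ, ℝ) f x (anchor x (X x))) • Y x

/-! ## Lie algebroids in local coordinates

The next few definitions are about trivial bundles over (open pieces of) a normed space. They are
only ever applied to the coordinate expression of a Lie algebroid and to its prolongations. -/

/-- The coordinate expression of a Lie algebroid with base coordinates in `X` and fibre coordinates
in `V` (with respect to a basis of sections): the components of the anchor and the structure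
functions, `struc x v w` being the value at `x` of the bracket of the sections with constant
components `v` and `w`. -/
structure AlgebroidChart (X V : Type*) [NormedAddCommGroup X] [NormedSpace ℝ X]
    [NormedAddCommGroup V] [NormedSpace ℝ V] where
  anchor : X → V →ₗ[ℝ] X
  struc : X → V →ₗ[ℝ] V →ₗ[ℝ] V

namespace AlgebroidChart

variable {X V : Type*} [NormedAddCommGroup X] [NormedSpace ℝ X]
  [NormedAddCommGroup V] [NormedSpace ℝ V]

/-- The derivative `ρ(σ)(f)` of a function `f` along a section `σ`. -/
def lieDeriv (A : AlgebroidChart X V) (σ : X → V) (f : X → ℝ) (x : X) : ℝ :=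
  fderiv ℝ f x (A.anchor x (σ x))

/-- The bracket of two sections: the extension of the structure functions by the Leibniz rule. -/
def bracket (A : AlgebroidChart X V) (σ τ : X → V) (x : X) : V :=
  A.struc x (σ x) (τ x) + fderiv ℝ τ x (A.anchor x (σ x)) - fderiv ℝ σ x (A.anchor x (τ x))

/-- The Lie algebroid differential of a 1-section. -/
def dOne (A : AlgebroidChart X V) (θ : X → V → ℝ) (σ τ : X → V) (x : X) : ℝ :=
  A.lieDeriv σ (fun y => θ y (τ y)) x - A.lieDeriv τ (fun y => θ y (σ y)) x
    - θ x (A.bracket σ τ x)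

/-- The Lie algebroid differential of a 2-section. -/
def dTwo (A : AlgebroidChart X V) (Ω : X → V → V → ℝ) (σ τ υ : X → V) (x : X) : ℝ :=
  A.lieDeriv σ (fun y => Ω y (τ y) (υ y)) x - A.lieDeriv τ (fun y => Ω y (σ y) (υ y)) x
    + A.lieDeriv υ (fun y => Ω y (σ y) (τ y)) x
    - Ω x (A.bracket σ τ x) (υ x) + Ω x (A.bracket σ υ x) (τ x) - Ω x (A.bracket τ υ x) (σ x)

/-- The prolongation of a Lie algebroid over a fibration `ν`, in coordinates `(x, y) ↦ x` for `ν`.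
Its fibre at `(x, y)` is `{(a, (u, v)) | ρ(a) = Tν (u, v) = u}`; such an element is recorded as
`(a, v)`, that is, by its components in the basis of sections `(e_A, ρ(e_A))`, `(0, ∂/∂y)`. The
anchor is `(a, (u, v)) ↦ (u, v)`, and the only nonzero brackets of basis sections are those of the
sections `(e_A, ρ(e_A))`, which bracket as the `e_A` do. -/
def prolong (A : AlgebroidChart X V) (Y : Type*) [NormedAddCommGroup Y] [NormedSpace ℝ Y] :
    AlgebroidChart (X × Y) (V × Y) where
  anchor := fun q => (A.anchor q.1).prodMap LinearMap.id
  struc := fun q => ((A.struc q.1).compl₁₂ (LinearMap.fst ℝ V Y) (LinearMap.fst ℝ V Y)).compr₂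
    (LinearMap.inl ℝ V Y)

/-- The Liouville section `⟨α, Tν(·)⟩` of the prolongation of the Lie algebroid `A.prolong Y` (with
fibres `V × Y`) over the dual bundle of `A.prolong Y`, when `V` and `Y` are coordinate spaces;
`α = (p, p̄)` are the fibre coordinates of the dual bundle with respect to the dual basis. -/
def liouville {n k : ℕ} (w : (X × (Fin k → ℝ)) × ((Fin n → ℝ) × (Fin k → ℝ)))
    (v : ((Fin n → ℝ) × (Fin k → ℝ)) × ((Fin n → ℝ) × (Fin k → ℝ))) : ℝ :=
  w.2.1 ⬝ᵥ v.1.1 + w.2.2 ⬝ᵥ v.1.2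

end AlgebroidChart

/-- The tangent space at `x` of an embedded submanifold `N` of a normed space: the velocities at
`x` of the smooth curves in `N`. -/
def velocities {X : Type*} [NormedAddCommGroup X] [NormedSpace ℝ X] (N : Set X) (x : X) : Set X :=
  {u | ∃ γ : ℝ → X, ContDiffAt ℝ ∞ γ 0 ∧ γ 0 = x ∧ (∀ᶠ t in nhds 0, γ t ∈ N) ∧ HasDerivAt γ u 0}

namespace AlgebroidChart

variable {X V : Type*} [NormedAddCommGroup X] [NormedSpace ℝ X]
  [NormedAddCommGroup V] [NormedSpace ℝ V]

/-- The fibre at `x ∈ N` of the restriction `ρ⁻¹(TN)` of a Lie algebroid to a submanifold `N`. -/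
def restrict (A : AlgebroidChart X V) (N : Set X) (x : X) : Set V :=
  {v | A.anchor x v ∈ velocities N x}

/-- The pullback to `ρ⁻¹(TN) → N` of the 2-section `Ω` is a symplectic section: it is nondegenerate
on each fibre, and closed. Sections of `ρ⁻¹(TN)` are given by ambient smooth extensions. -/
def IsSymplecticOn (A : AlgebroidChart X V) (Ω : X → V → V → ℝ) (N : Set X) : Prop :=
  (∀ x ∈ N, ∀ v ∈ A.restrict N x, (∀ w ∈ A.restrict N x, Ω x v w = 0) → v = 0) ∧
  ∀ σ τ υ : X → V, ContDiff ℝ ∞ σ → ContDiff ℝ ∞ τ → ContDiff ℝ ∞ υ →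
    (∀ x ∈ N, σ x ∈ A.restrict N x ∧ τ x ∈ A.restrict N x ∧ υ x ∈ A.restrict N x) →
      ∀ x ∈ N, A.dTwo Ω σ τ υ x = 0

/-- The canonical 2-section `-dλ` on the prolongation over the dual bundle of `A.prolong Y`. -/
def canonicalTwoSection {n k : ℕ} (A : AlgebroidChart X (Fin n → ℝ))
    (w : (X × (Fin k → ℝ)) × ((Fin n → ℝ) × (Fin k → ℝ)))
    (v v' : ((Fin n → ℝ) × (Fin k → ℝ)) × ((Fin n → ℝ) × (Fin k → ℝ))) : ℝ :=
  - ((A.prolong (Fin k → ℝ)).prolong ((Fin n → ℝ) × (Fin k → ℝ))).dOne liouville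
      (fun _ => v) (fun _ => v') w

end AlgebroidChart

/-- Coordinates `((x, y), z)` on `E⁽²⁾`. -/
abbrev AdmCoord (m n : ℕ) : Type :=
  (EuclideanSpace ℝ (Fin m) × (Fin n → ℝ)) × (Fin n → ℝ)

/-- Coordinates `((x, y), ((p, p̄), z))` on `W₀ = E⁽²⁾ ×_E (𝒯E)*`. -/
abbrev WCoord (m n : ℕ) : Type :=
  (EuclideanSpace ℝ (Fin m) × (Fin n → ℝ)) ×
    (((Fin n → ℝ) × (Fin n → ℝ)) × (Fin n → ℝ))

/-- Fibre coordinates of `𝒯^ν 𝒯^τ E` at a point of `W₀`. -/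
abbrev WFibre (n : ℕ) : Type :=
  ((Fin n → ℝ) × (Fin n → ℝ)) × (((Fin n → ℝ) × (Fin n → ℝ)) × (Fin n → ℝ))

/-- The projection `W₀ → E⁽²⁾`. -/
def WCoord.toAdm {m n : ℕ} (w : WCoord m n) : AdmCoord m n := (w.1, w.2.2)

/-- The partial derivative `∂f/∂z^B`. -/
def dz {m n : ℕ} (f : AdmCoord m n → ℝ) (B : Fin n) (q : AdmCoord m n) : ℝ :=
  fderiv ℝ f q (0, Pi.single B 1)

namespace LieAlgebroid

variable {m n : ℕ} {M : Type*} [TopologicalSpace M]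
  [ChartedSpace (EuclideanSpace ℝ (Fin m)) M] [IsManifold (𝓡 m) ∞ M] {E : M → Type*}
  [TopologicalSpace (TotalSpace (EuclideanSpace ℝ (Fin n)) E)]
  [∀ x, AddCommGroup (E x)] [∀ x, Module ℝ (E x)] [∀ x, TopologicalSpace (E x)]
  [FiberBundle (EuclideanSpace ℝ (Fin n)) E] [VectorBundle ℝ (EuclideanSpace ℝ (Fin n)) E]

/-- The set `E⁽²⁾` of admissible elements: the tangent vectors `v` to `E` at points `e` such that
`ρ(e) = T_e τ (v)`. -/
def Adm (A : LieAlgebroid (m := m) (n := n) E) : Type _ :=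
  {v : TangentBundle ((𝓡 m).prod 𝓘(ℝ, EuclideanSpace ℝ (Fin n)))
      (TotalSpace (EuclideanSpace ℝ (Fin n)) E) //
    A.anchor v.proj.proj v.proj.snd =
      mfderiv ((𝓡 m).prod 𝓘(ℝ, EuclideanSpace ℝ (Fin n))) (𝓡 m)
        (TotalSpace.proj : TotalSpace (EuclideanSpace ℝ (Fin n)) E → M) v.proj v.snd}

/-- Local coordinates for a Lie algebroid: a chart of `M` and a basis of sections of `E` over the
chart domain. (Near any point every local basis of sections is of this form, by shrinking the
domain and extending the sections.) -/
structure LocalCoordinates (A : LieAlgebroid (m := m) (n := n) E) where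
  chart : OpenPartialHomeomorph M (EuclideanSpace ℝ (Fin m))
  chart_mem : chart ∈ IsManifold.maximalAtlas (𝓡 m) ∞ M
  frame : Fin n → Cₛ^∞⟮𝓡 m; EuclideanSpace ℝ (Fin n), E⟯
  isLocalFrameOn : IsLocalFrameOn (𝓡 m) (EuclideanSpace ℝ (Fin n)) ∞
    (fun i x => frame i x) chart.source

namespace LocalCoordinates

variable {A : LieAlgebroid (m := m) (n := n) E} (κ : A.LocalCoordinates)

/-- The coordinate expression of the Lie algebroid: `ρ(e_A) = ρ_A^i ∂/∂x^i` and
`[e_A, e_B] = C_{AB}^C e_C`. -/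
def toChart : AlgebroidChart (EuclideanSpace ℝ (Fin m)) (Fin n → ℝ) where
  anchor := fun u => Fintype.linearCombination ℝ fun i =>
    (show EuclideanSpace ℝ (Fin m) from
      mfderiv (𝓡 m) (𝓡 m) κ.chart (κ.chart.symm u)
        (A.anchor (κ.chart.symm u) (κ.frame i (κ.chart.symm u))))
  struc := fun u => LinearMap.mk₂ ℝ
    (fun y y' l => ∑ i, ∑ j, y i * y' j * κ.isLocalFrameOn.coeff l (κ.chart.symm u)
      (A.bracket (κ.frame i) (κ.frame j) (κ.chart.symm u)))
    (fun y₁ y₂ y' => by ext l; simp [add_mul, Finset.sum_add_distrib])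
    (fun c y y' => by ext l; simp [Finset.mul_sum, mul_assoc])
    (fun y y₁ y₂ => by ext l; simp [mul_add, add_mul, Finset.sum_add_distrib])
    (fun c y y' => by ext l; simp [Finset.mul_sum, mul_assoc, mul_left_comm])

/-- The coordinates `(x, y)` on `E`: the point `y^A e_A(x)`. -/
def point (q : EuclideanSpace ℝ (Fin m) × (Fin n → ℝ)) :
    TotalSpace (EuclideanSpace ℝ (Fin n)) E :=
  ⟨κ.chart.symm q.1, ∑ i, q.2 i • κ.frame i (κ.chart.symm q.1)⟩

/-- The tangent vector to `E` with coordinates `(x, y; ρ(x) y, z)`. -/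
def admVector (q : AdmCoord m n) :
    TangentBundle ((𝓡 m).prod 𝓘(ℝ, EuclideanSpace ℝ (Fin n)))
      (TotalSpace (EuclideanSpace ℝ (Fin n)) E) :=
  ⟨κ.point q.1, mfderiv 𝓘(ℝ, EuclideanSpace ℝ (Fin m) × (Fin n → ℝ))
    ((𝓡 m).prod 𝓘(ℝ, EuclideanSpace ℝ (Fin n))) κ.point q.1
      ((κ.toChart.anchor q.1.1 q.1.2, q.2) : EuclideanSpace ℝ (Fin m) × (Fin n → ℝ))⟩

theorem admVector_mem [ContMDiffVectorBundle ∞ (EuclideanSpace ℝ (Fin n)) E (𝓡 m)]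
    (q : AdmCoord m n) (hq : q.1.1 ∈ κ.chart.target) :
    A.anchor (κ.admVector q).proj.proj (κ.admVector q).proj.snd =
      mfderiv ((𝓡 m).prod 𝓘(ℝ, EuclideanSpace ℝ (Fin n))) (𝓡 m)
        (TotalSpace.proj : TotalSpace (EuclideanSpace ℝ (Fin n)) E → M)
        (κ.admVector q).proj (κ.admVector q).snd := by
  have htgt : κ.chart.symm q.1.1 ∈ κ.chart.source := κ.chart.map_target hq
  have hch : MDifferentiableAt (𝓡 m) (𝓡 m) κ.chart (κ.chart.symm q.1.1) :=
    ((contMDiffOn_of_mem_maximalAtlas κ.chart_mem).contMDiffAt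
      (κ.chart.open_source.mem_nhds htgt)).mdifferentiableAt (by simp)
  have hsymm : ContMDiffAt (𝓡 m) (𝓡 m) ∞ κ.chart.symm q.1.1 :=
    (contMDiffOn_symm_of_mem_maximalAtlas κ.chart_mem).contMDiffAt
      (κ.chart.open_target.mem_nhds hq)
  have hfst : ContMDiffAt 𝓘(ℝ, EuclideanSpace ℝ (Fin m) × (Fin n → ℝ)) (𝓡 m) ∞
      (fun p : EuclideanSpace ℝ (Fin m) × (Fin n → ℝ) => κ.chart.symm p.1) q.1 :=
    ContMDiffAt.comp q.1 (g := κ.chart.symm) (f := Prod.fst) hsymm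
      (contDiff_fst.contMDiff.contMDiffAt)
  have hpoint : MDifferentiableAt 𝓘(ℝ, EuclideanSpace ℝ (Fin m) × (Fin n → ℝ))
      ((𝓡 m).prod 𝓘(ℝ, EuclideanSpace ℝ (Fin n))) κ.point q.1 := by
    refine ContMDiffAt.mdifferentiableAt (n := ∞) ?_ (by simp)
    rw [Bundle.contMDiffAt_totalSpace]
    refine ⟨hfst, ?_⟩
    set e := trivializationAt (EuclideanSpace ℝ (Fin n)) E (κ.chart.symm q.1.1) with he
    have hbase : ∀ᶠ p in nhds q.1, κ.chart.symm p.1 ∈ e.baseSet :=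
      hfst.continuousAt.eventually_mem
        (e.open_baseSet.mem_nhds (mem_baseSet_trivializationAt _ _ _))
    have hsum : ContMDiffAt 𝓘(ℝ, EuclideanSpace ℝ (Fin m) × (Fin n → ℝ))
        𝓘(ℝ, EuclideanSpace ℝ (Fin n)) ∞
        (fun p : EuclideanSpace ℝ (Fin m) × (Fin n → ℝ) =>
          ∑ i, p.2 i • (e ⟨κ.chart.symm p.1, κ.frame i (κ.chart.symm p.1)⟩).2) q.1 := by
      refine ContMDiffAt.sum fun i _ => ?_
      have h₁ : ContMDiffAt 𝓘(ℝ, EuclideanSpace ℝ (Fin m) × (Fin n → ℝ)) 𝓘(ℝ, ℝ) ∞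
          (fun p : EuclideanSpace ℝ (Fin m) × (Fin n → ℝ) => p.2 i) q.1 :=
        ContDiffAt.contMDiffAt (by fun_prop)
      have h₂ := (Bundle.contMDiffAt_section (IB := 𝓡 m) (n := ∞) (s := fun x => κ.frame i x)
        (κ.chart.symm q.1.1)).1 ((κ.frame i).contMDiff _)
      exact h₁.smul (ContMDiffAt.comp q.1
        (f := fun p : EuclideanSpace ℝ (Fin m) × (Fin n → ℝ) => κ.chart.symm p.1) h₂ hfst)
    refine hsum.congr_of_eventuallyEq ?_
    filter_upwards [hbase] with p hp
    have h := fun v => Trivialization.linearMapAt_apply (R := ℝ) e (b := κ.chart.symm p.1) v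
    simp only [hp, if_true] at h
    show (e ⟨κ.chart.symm p.1, ∑ i, p.2 i • κ.frame i (κ.chart.symm p.1)⟩).2 = _
    rw [← h, map_sum]
    refine Finset.sum_congr rfl fun i _ => ?_
    rw [map_smul, h]
  have hanchor : κ.toChart.anchor q.1.1 q.1.2 =
      (show EuclideanSpace ℝ (Fin m) from mfderiv (𝓡 m) (𝓡 m) κ.chart (κ.chart.symm q.1.1)
        (A.anchor (κ.chart.symm q.1.1) (κ.point q.1).snd)) := by
    simp only [toChart, point, map_sum, map_smul]
    rfl
  have hproj : MDifferentiableAt ((𝓡 m).prod 𝓘(ℝ, EuclideanSpace ℝ (Fin n))) (𝓡 m)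
      (TotalSpace.proj : TotalSpace (EuclideanSpace ℝ (Fin n)) E → M) (κ.point q.1) :=
    Bundle.mdifferentiableAt_proj E
  have hcomp := mfderiv_comp_apply q.1 hproj hpoint
    ((κ.toChart.anchor q.1.1 q.1.2, q.2) : EuclideanSpace ℝ (Fin m) × (Fin n → ℝ))
  refine Eq.trans ?_ hcomp
  have hfst' : MDifferentiableAt 𝓘(ℝ, EuclideanSpace ℝ (Fin m) × (Fin n → ℝ))
     (𝓡 m) (Prod.fst : EuclideanSpace ℝ (Fin m) × (Fin n → ℝ) → EuclideanSpace ℝ (Fin m)) q.1 :=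
     (contDiff_fst.contMDiff (n := ∞)).contMDiffAt.mdifferentiableAt (by simp)
  have hcomp2 := mfderiv_comp_apply q.1 (hsymm.mdifferentiableAt (by simp)) hfst'
    ((κ.toChart.anchor q.1.1 q.1.2, q.2) : EuclideanSpace ℝ (Fin m) × (Fin n → ℝ))
  refine Eq.trans ?_ hcomp2.symm
  have hd : mfderiv 𝓘(ℝ, EuclideanSpace ℝ (Fin m) × (Fin n → ℝ)) (𝓡 m)
     (Prod.fst : EuclideanSpace ℝ (Fin m) × (Fin n → ℝ) → EuclideanSpace ℝ (Fin m)) q.1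
    ((κ.toChart.anchor q.1.1 q.1.2, q.2) : EuclideanSpace ℝ (Fin m) × (Fin n → ℝ)) =
      κ.toChart.anchor q.1.1 q.1.2 := by
    rw [mfderiv_eq_fderiv, fderiv_fst]; rfl
  rw [hd, hanchor]
  have hinv : mfderiv (𝓡 m) (𝓡 m) (κ.chart.symm ∘ κ.chart) (κ.chart.symm q.1.1) =
      ContinuousLinearMap.id ℝ (TangentSpace (𝓡 m) (κ.chart.symm q.1.1)) := by
    have h : (κ.chart.symm ∘ κ.chart) =ᶠ[nhds (κ.chart.symm q.1.1)] id := by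
      filter_upwards [κ.chart.open_source.mem_nhds htgt] with x hx
      exact κ.chart.left_inv hx
    rw [h.mfderiv_eq, mfderiv_id]
  have hcomp3 := mfderiv_comp_apply_of_eq (κ.chart.symm q.1.1)
    (hsymm.mdifferentiableAt (by simp)) hch (κ.chart.right_inv hq)
    (A.anchor (κ.chart.symm q.1.1) (κ.point q.1).snd)
  rw [hinv] at hcomp3
  exact hcomp3

/-- The admissible element with coordinates `(x, y, z)`. -/
def adm [ContMDiffVectorBundle ∞ (EuclideanSpace ℝ (Fin n)) E (𝓡 m)]
    (q : AdmCoord m n) (hq : q.1.1 ∈ κ.chart.target) : A.Adm :=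
  ⟨κ.admVector q, κ.admVector_mem q hq⟩

open scoped Classical in
/-- The coordinate expression of a function on `E⁽²⁾` (zero outside the coordinate domain). -/
def expr [ContMDiffVectorBundle ∞ (EuclideanSpace ℝ (Fin n)) E (𝓡 m)]
    (L : A.Adm → ℝ) (q : AdmCoord m n) : ℝ :=
  if hq : q.1.1 ∈ κ.chart.target then L (κ.adm q hq) else 0

end LocalCoordinates

variable [ContMDiffVectorBundle ∞ (EuclideanSpace ℝ (Fin n)) E (𝓡 m)]

/-- Smooth functions on `E⁽²⁾`. -/
def IsSmooth {A : LieAlgebroid (m := m) (n := n) E} (L : A.Adm → ℝ) : Prop :=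
  ∀ κ : A.LocalCoordinates, ContDiffOn ℝ ∞ (κ.expr L) {q | q.1.1 ∈ κ.chart.target}

/-! ## Second-order constraints -/

/-- Local coordinates on `E⁽²⁾` together with `k` local constraint functions `Φ^α` defining the
subset `S` of `E⁽²⁾` on an open coordinate domain, the matrix `(∂Φ^α/∂z^B)` having maximal rank at
the points of `S`. -/
structure ConstraintChart {A : LieAlgebroid (m := m) (n := n) E} (S : Set A.Adm) (k : ℕ) where
  coords : A.LocalCoordinates
  dom : Set (AdmCoord m n)
  isOpen_dom : IsOpen dom
  dom_subset : ∀ q ∈ dom, q.1.1 ∈ coords.chart.target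
  Φ : Fin k → AdmCoord m n → ℝ
  contDiffOn : ∀ α, ContDiffOn ℝ ∞ (Φ α) dom
  mem_iff : ∀ q (hq : q ∈ dom), coords.adm q (dom_subset q hq) ∈ S ↔ ∀ α, Φ α q = 0
  rank_eq : ∀ q ∈ dom, (∀ α, Φ α q = 0) → (Matrix.of fun α B => dz (Φ α) B q).rank = k

/-- An embedded submanifold `𝓜` of `E⁽²⁾` of codimension `k` which projects onto `E` by a
surjective submersion. -/
structure ConstraintSubmanifold (A : LieAlgebroid (m := m) (n := n) E) (k : ℕ) where
  carrier : Set A.Adm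
  exists_chart : ∀ a ∈ carrier, ∃ (c : ConstraintChart carrier k) (q : AdmCoord m n)
    (hq : q ∈ c.dom), c.coords.adm q (c.dom_subset q hq) = a
  surjective : ∀ e : TotalSpace (EuclideanSpace ℝ (Fin n)) E, ∃ a ∈ carrier, a.1.proj = e

namespace ConstraintChart

variable {A : LieAlgebroid (m := m) (n := n) E} {S : Set A.Adm} {k : ℕ}
  (c : ConstraintChart S k) (L : A.Adm → ℝ)

/-- The coordinate expression of the Lie algebroid `𝒯^ν 𝒯^τ E → W₀`. Its base coordinates are
`((x, y), ((p, p̄), z))`, its fibre coordinates are the components with respect to the basis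
`ẽ_A^{(1,1)}, ẽ_A^{(2,1)}, (ẽ^A)^{(1,2)}, (ẽ^A)^{(2,2)}, ě_A^{(1,2)}`. -/
def algebroidW :
    AlgebroidChart (WCoord m n) (WFibre n) :=
  (c.coords.toChart.prolong (Fin n → ℝ)).prolong (((Fin n → ℝ) × (Fin n → ℝ)) × (Fin n → ℝ))

/-- The presymplectic 2-section `Ω_{W₀}`: the pullback of the canonical symplectic section of the
prolongation of `𝒯^τ E` over `(𝒯^τ E)*` by `𝒯π₂`, where `π₂ : W₀ → (𝒯^τ E)*`. -/
def Ω₀ (w : WCoord m n) (v v' : WFibre n) : ℝ :=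
  c.coords.toChart.canonicalTwoSection (w.1, w.2.1) (v.1, v.2.1) (v'.1, v'.2.1)

/-- `p̄_A - ∂L/∂z^A + λ_α ∂Φ^α/∂z^A = 0` for all `A`. -/
def IsMultiplier (w : WCoord m n) (lam : Fin k → ℝ) : Prop :=
  ∀ B, w.2.1.2 B - dz (c.coords.expr L) B w.toAdm + ∑ α, lam α * dz (c.Φ α) B w.toAdm = 0

/-- The first constraint submanifold `W̄₁`, in coordinates. -/
def W₁ : Set (WCoord m n) :=
  {w | w.toAdm ∈ c.dom ∧ (∀ α, c.Φ α w.toAdm = 0) ∧ ∃ lam, c.IsMultiplier L w lam}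

/-- The pullback `Ω_{W̄₁}` of `Ω_{W₀}` to `W̄₁` is a symplectic section over the chart domain. -/
def IsSymplectic : Prop := c.algebroidW.IsSymplecticOn c.Ω₀ (c.W₁ L)

/-- The bordered matrix. -/
def borderedMatrix (q : AdmCoord m n) (lam : Fin k → ℝ) :
    Matrix (Fin n ⊕ Fin k) (Fin n ⊕ Fin k) ℝ :=
  Matrix.fromBlocks
    (Matrix.of fun B C => dz (dz (c.coords.expr L) C) B q + ∑ α, lam α * dz (dz (c.Φ α) C) B q)
    (Matrix.of fun B α => dz (c.Φ α) B q)
    (Matrix.of fun α B => dz (c.Φ α) B q)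
    0

/-- The bordered matrix is nondegenerate along `W̄₁`, over the chart domain. -/
def IsRegular : Prop :=
  ∀ w ∈ c.W₁ L, ∀ lam, c.IsMultiplier L w lam → (c.borderedMatrix L w.toAdm lam).Nondegenerate

end ConstraintChart

/-- `Ω_{W̄₁}` is a symplectic section of `(ρ^ν)⁻¹(TW̄₁) → W̄₁`. Nondegeneracy and closedness are
conditions at the points of `W̄₁`, which is covered by the open pieces `W₁` over the charts of the
constraint submanifold; they are imposed in every system of local coordinates. -/
def ConstraintSubmanifold.IsSymplecticW₁ {A : LieAlgebroid (m := m) (n := n) E} {k : ℕ}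
    (N : A.ConstraintSubmanifold k) (L : A.Adm → ℝ) : Prop :=
  ∀ c : ConstraintChart N.carrier k, c.IsSymplectic L

end LieAlgebroid

end

/-! Write an element of the fibre at a point of $W_0$ as $v=(a,b;P,\bar P,Z)$. Then
$\Omega_{W_0}(v,v')=P'\cdot a+\bar P'\cdot b-P\cdot a'-\bar P\cdot b'+p\cdot C(a,a')$, where $C$ are
the structure functions; `Ω₀_apply` records this.

Closedness imposes no condition. `dTwo_Ω₀` shows $d\Omega_{W_0}=0$ on $W_0$ itself: by tensoriality
constant sections suffice, and for them the differential reduces to $p$ paired with the Jacobi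
identity for $C$. Everything therefore rests on nondegeneracy.

The tangent spaces of $\overline W_1$ are given by the linearized equations with a free variation
$\dot\lambda$ of the multipliers (`mem_velocities_W₁`). For $a=b=0$ these say exactly that the
bordered matrix sends $(Z,-\dot\lambda)$ to $(\bar P,0)$, with $P$ free (`isTangent_vertical`). If
the matrix is invertible, the vertical vectors realize all $(P,\bar P)$, so a vector in the kernel
of the form has $a=b=0$. Every $(a',b')$ lifts to a tangent vector, so also $P=\bar P=0$; then
$(Z,-\dot\lambda)$ is in the kernel of the matrix and $Z=0$. Conversely, a kernel vector $(Z,\mu)$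
of the matrix makes $(0,0;0,0,Z)$ tangent, and this vector is annihilated by $\Omega_{W_0}$. So
$Z=0$, and maximal rank of $\partial\Phi/\partial z$ gives $\mu=0$.

One sign needs care: with the equation $\bar p-\partial L/\partial z+\lambda\,\partial\Phi/\partial
z=0$, linearizing at multiplier $\lambda$ produces the matrix at $-\lambda$. Since $\bar p$ is free,
every $\lambda$ occurs over every point of $\mathcal M$ in the chart
(`exists_mem_W₁_of_multiplier`), so the conditions over all of $\overline W_1$ agree although they
need not agree point by point. -/

/-! ### Smooth dependence of solutions of linear systems -/

section Cramer

variable {E H M : Type*} [NormedAddCommGroup E] [NormedSpace ℝ E] [TopologicalSpace H]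
  {I : ModelWithCorners ℝ E H} [TopologicalSpace M] [ChartedSpace H M] {r : ℕ∞ω} {x : M}
  {ι : Type*} [Fintype ι] [DecidableEq ι]

theorem ContMDiffAt.matrix_det {A : M → Matrix ι ι ℝ}
    (hA : ∀ i j, ContMDiffAt I 𝓘(ℝ, ℝ) r (fun y => A y i j) x) :
    ContMDiffAt I 𝓘(ℝ, ℝ) r (fun y => (A y).det) x := by
  simp only [Matrix.det_apply']
  exact ContMDiffAt.sum fun σ _ => contMDiffAt_const.mul (contMDiffAt_finsetProd fun i _ => hA _ _)

/-- The solution of a linear system depends smoothly on the data, where the determinant does not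
vanish. -/
theorem ContMDiffAt.of_mulVec_eq {A : M → Matrix ι ι ℝ} {b y : M → ι → ℝ}
    (hA : ∀ i j, ContMDiffAt I 𝓘(ℝ, ℝ) r (fun y => A y i j) x)
    (hb : ∀ i, ContMDiffAt I 𝓘(ℝ, ℝ) r (fun y => b y i) x)
    (hdet : (A x).det ≠ 0) (h : ∀ᶠ t in nhds x, A t *ᵥ y t = b t) (i : ι) :
    ContMDiffAt I 𝓘(ℝ, ℝ) r (fun t => y t i) x := by
  have hd := ContMDiffAt.matrix_det hA
  have hc : ContMDiffAt I 𝓘(ℝ, ℝ) r (fun t => ((A t).updateCol i (b t)).det) x := by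
    refine ContMDiffAt.matrix_det fun j l => ?_
    by_cases hl : l = i
    · subst hl; simpa using hb j
    · simpa [Matrix.updateCol_ne hl] using hA j l
  refine (hc.div₀ hd hdet).congr_of_eventuallyEq ?_
  filter_upwards [h, hd.continuousAt.eventually_ne hdet] with t ht hne
  -- Cramer's rule in the form `cramer A (A y) = det A • y`, which holds without dividing by the
  -- determinant.
  have h1 : (A t).cramer (A t *ᵥ y t) = (A t).det • y t := by
    rw [Matrix.cramer_eq_adjugate_mulVec, Matrix.mulVec_mulVec, Matrix.adjugate_mul,
      Matrix.smul_mulVec, Matrix.one_mulVec]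
  have h2 := congrFun h1 i
  rw [ht, Matrix.cramer_apply] at h2
  change y t i = ((A t).updateCol i (b t)).det / (A t).det
  rw [h2, Pi.smul_apply, smul_eq_mul, mul_div_cancel_left₀ _ hne]

end Cramer

/-! ### Curves in level sets -/

/-- Near a point where a map to `ℝᵏ` is a submersion, every vector in the kernel of the derivative
is the velocity of a smooth curve in the level set. -/
theorem exists_curve_in_levelSet {Q : Type*} [NormedAddCommGroup Q] [NormedSpace ℝ Q]
    {k : ℕ} {Φ : Fin k → Q → ℝ} {q u : Q} (hΦ : ∀ α, ContDiffAt ℝ ∞ (Φ α) q)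
    (R : (Fin k → ℝ) →L[ℝ] Q) (hR : ∀ μ α, fderiv ℝ (Φ α) q (R μ) = μ α)
    (hu : ∀ α, fderiv ℝ (Φ α) q u = 0) :
    ∃ γ : ℝ → Q, ContDiffAt ℝ ∞ γ 0 ∧ γ 0 = q ∧ HasDerivAt γ u 0 ∧
      ∀ᶠ t in nhds 0, ∀ α, Φ α (γ t) = Φ α q := by
  -- Move along $u$ by $t$ and correct along the right inverse `R`. At the origin the derivative of
  -- $F(t,s)=\Phi(q+tu+Rs)$ is the identity in $s$ and zero in $t$.
  set A : ℝ × (Fin k → ℝ) →L[ℝ] Q := (ContinuousLinearMap.toSpanSingleton ℝ u).coprod R with hA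
  set F : ℝ × (Fin k → ℝ) → Fin k → ℝ := fun s α => Φ α (q + A s) with hF
  have h0 : q + A (0, 0) = q := by
    have : A (0, 0) = 0 := A.map_zero
    rw [this, add_zero]
  have hFα : ∀ α, HasFDerivAt (fun s => F s α) ((fderiv ℝ (Φ α) q).comp A) (0, 0) := by
    intro α
    have h1 : HasFDerivAt (Φ α) (fderiv ℝ (Φ α) q) (q + A (0, 0)) := by
      rw [h0]; exact ((hΦ α).differentiableAt (by simp)).hasFDerivAt
    exact h1.comp (0, 0) (A.hasFDerivAt.const_add q)
  have hFd : HasFDerivAt F (ContinuousLinearMap.pi fun α => (fderiv ℝ (Φ α) q).comp A) (0, 0) :=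
    hasFDerivAt_pi.2 hFα
  have hFc : ContDiffAt ℝ ∞ F (0, 0) := by
    refine contDiffAt_pi.2 fun α => ?_
    refine ContDiffAt.comp (g := Φ α) (f := fun s => q + A s) _ ?_ (by fun_prop)
    rw [h0]; exact hΦ α
  have hinr : fderiv ℝ F (0, 0) ∘L .inr ℝ ℝ (Fin k → ℝ) = ContinuousLinearMap.id ℝ _ := by
    rw [hFd.fderiv]
    ext1 μ
    funext α
    simp [hA, hR]
  have hinl : fderiv ℝ F (0, 0) ∘L .inl ℝ ℝ (Fin k → ℝ) = 0 := by
    rw [hFd.fderiv]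
    ext α
    simp [hA, hu]
  have hinv : (fderiv ℝ F (0, 0) ∘L .inr ℝ ℝ (Fin k → ℝ)).IsInvertible := by
    rw [hinr]; exact ⟨.refl ℝ _, rfl⟩
  have hn : (∞ : ℕ∞ω) ≠ 0 := by simp
  set ψ := hFc.implicitFunction hn hinv with hψ
  have hψ0 : ψ 0 = 0 := hFc.implicitFunction_apply_self hn hinv
  have hψc : ContDiffAt ℝ ∞ ψ 0 := hFc.contDiffAt_implicitFunction hn hinv
  -- The correction has zero velocity because $u$ is in the kernel of the derivative, so the
  -- corrected curve still has velocity $u$.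
  have hψd : HasFDerivAt ψ (0 : ℝ →L[ℝ] Fin k → ℝ) 0 := by
    have := (hFc.hasStrictFDerivAt_implicitFunction hn hinv).hasFDerivAt
    rw [hinl] at this
    simpa using this
  have hψe : ∀ᶠ t in nhds (0 : ℝ), F (t, ψ t) = F (0, 0) :=
    hFc.eventually_apply_implicitFunction hn hinv
  refine ⟨fun t => q + A (t, ψ t), ?_, ?_, ?_, ?_⟩
  · have : ContDiffAt ℝ ∞ (fun t => A (t, ψ t)) 0 :=
      A.contDiff.contDiffAt.comp (0 : ℝ) (contDiffAt_id.prodMk hψc)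
    exact contDiffAt_const.add this
  · simp only [hψ0, h0]
  · have h1 : HasFDerivAt (fun t : ℝ => (t, ψ t))
        ((ContinuousLinearMap.id ℝ ℝ).prod (0 : ℝ →L[ℝ] Fin k → ℝ)) 0 :=
      (hasFDerivAt_id (0 : ℝ)).prodMk hψd
    have h2 := ((A.hasFDerivAt.comp (0 : ℝ) h1).const_add q).hasDerivAt
    have h3 : (A.comp ((ContinuousLinearMap.id ℝ ℝ).prod (0 : ℝ →L[ℝ] Fin k → ℝ))) 1 = u := by
      simp [hA]
    rw [h3] at h2
    exact h2
  · filter_upwards [hψe] with t ht α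
    have := congrFun ht α
    simp only [hF] at this
    rw [this, h0]

/-! ### Derivatives in the $z$ directions -/

section AdmCoordinates

variable {m n : ℕ} {f : AdmCoord m n → ℝ} {q : AdmCoord m n}

theorem ContDiffAt.dz (hf : ContDiffAt ℝ ∞ f q) (B : Fin n) :
    ContDiffAt ℝ ∞ (dz f B) q :=
  (hf.fderiv_right (m := ∞) (by simp)).clm_apply contDiffAt_const

theorem dz_dz_comm (hf : ContDiffAt ℝ ∞ f q) (B C : Fin n) :
    dz (dz f C) B q = dz (dz f B) C q := by
  have hd : DifferentiableAt ℝ (fderiv ℝ f) q :=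
    (hf.fderiv_right (m := ∞) (by simp)).differentiableAt (by simp)
  have key : ∀ B C : Fin n, dz (dz f C) B q =
      fderiv ℝ (fderiv ℝ f) q (0, Pi.single B 1) (0, Pi.single C 1) := by
    intro B C
    have : HasFDerivAt (dz f C) ((fderiv ℝ (fderiv ℝ f) q).flip (0, Pi.single C 1)) q := by
      have h := hd.hasFDerivAt.clm_apply
        (hasFDerivAt_const ((0, Pi.single C 1) : AdmCoord m n) q)
      simp only [ContinuousLinearMap.comp_zero, zero_add] at h
      exact h
    change fderiv ℝ (dz f C) q _ = _
    rw [this.fderiv]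
    rfl
  rw [key, key]
  refine hf.isSymmSndFDerivAt ?_ _ _
  rw [minSmoothness_of_isRCLikeNormedField]
  exact WithTop.coe_le_coe.2 le_top

/-- The derivative of `f` in a vertical direction. -/
theorem fderiv_apply_zero_left (f : AdmCoord m n → ℝ) (q : AdmCoord m n) (Z : Fin n → ℝ) :
    fderiv ℝ f q (0, Z) = ∑ B, dz f B q * Z B := by
  have hZ : ((0, Z) : AdmCoord m n) = ∑ B, Z B • ((0, Pi.single B 1) : AdmCoord m n) := by
    refine Prod.ext ?_ ?_
    · simp [Prod.fst_sum]
    · funext j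
      simp [Prod.snd_sum, Finset.sum_apply, Pi.single_apply]
  rw [hZ, map_sum]
  refine Finset.sum_congr rfl fun B _ => ?_
  rw [map_smul, smul_eq_mul, mul_comm]
  rfl

end AdmCoordinates

section Deriv

variable {F G : Type*} [NormedAddCommGroup F] [NormedSpace ℝ F] [NormedAddCommGroup G]
  [NormedSpace ℝ G] {f : ℝ → F × G} {f' : F × G} {t : ℝ}

theorem HasDerivAt.prod_fst (h : HasDerivAt f f' t) : HasDerivAt (fun s => (f s).1) f'.1 t := by
  simpa using (HasDerivAt.hasFDerivAt h).fst.hasDerivAt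

theorem HasDerivAt.prod_snd (h : HasDerivAt f f' t) : HasDerivAt (fun s => (f s).2) f'.2 t := by
  simpa using (HasDerivAt.hasFDerivAt h).snd.hasDerivAt

end Deriv

/-! ### The canonical 2-section in coordinates -/

/-- The Liouville section is linear in $(p,\bar p)$, so its derivative along a constant section only
sees the vertical components. The bracket of constant sections contributes the structure functions,
which pair with $p$ alone. -/
theorem AlgebroidChart.canonicalTwoSection_apply {X : Type*} [NormedAddCommGroup X]
    [NormedSpace ℝ X] {n k : ℕ} (A : AlgebroidChart X (Fin n → ℝ))
    (w : (X × (Fin k → ℝ)) × ((Fin n → ℝ) × (Fin k → ℝ)))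
    (v v' : ((Fin n → ℝ) × (Fin k → ℝ)) × ((Fin n → ℝ) × (Fin k → ℝ))) :
    A.canonicalTwoSection w v v' = v'.2.1 ⬝ᵥ v.1.1 + v'.2.2 ⬝ᵥ v.1.2 - v.2.1 ⬝ᵥ v'.1.1
      - v.2.2 ⬝ᵥ v'.1.2 + w.2.1 ⬝ᵥ A.struc w.1.1 v.1.1 v'.1.1 := by
  have key : ∀ v v' : ((Fin n → ℝ) × (Fin k → ℝ)) × ((Fin n → ℝ) × (Fin k → ℝ)),
      ((A.prolong (Fin k → ℝ)).prolong ((Fin n → ℝ) × (Fin k → ℝ))).lieDeriv (fun _ => v)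
        (fun y => liouville y v') w = v.2.1 ⬝ᵥ v'.1.1 + v.2.2 ⬝ᵥ v'.1.2 := by
    intro v v'
    set lin : ((X × (Fin k → ℝ)) × ((Fin n → ℝ) × (Fin k → ℝ))) →L[ℝ] ℝ :=
      ((∑ i, v'.1.1 i • ContinuousLinearMap.proj (R := ℝ) (φ := fun _ : Fin n => ℝ) i).comp
          (ContinuousLinearMap.fst ℝ (Fin n → ℝ) (Fin k → ℝ)) +
        (∑ i, v'.1.2 i • ContinuousLinearMap.proj (R := ℝ) (φ := fun _ : Fin k => ℝ) i).comp
          (ContinuousLinearMap.snd ℝ (Fin n → ℝ) (Fin k → ℝ))).comp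
        (ContinuousLinearMap.snd ℝ (X × (Fin k → ℝ)) ((Fin n → ℝ) × (Fin k → ℝ))) with hlin
    have hl : (fun y : (X × (Fin k → ℝ)) × ((Fin n → ℝ) × (Fin k → ℝ)) => liouville y v') =
        lin := by
      funext y
      simp [hlin, liouville, dotProduct, mul_comm]
    unfold lieDeriv
    rw [hl, lin.fderiv]
    simp [hlin, prolong, dotProduct, mul_comm]
  have hb : liouville w
      (((A.prolong (Fin k → ℝ)).prolong ((Fin n → ℝ) × (Fin k → ℝ))).bracket (fun _ => v)
        (fun _ => v') w) = w.2.1 ⬝ᵥ A.struc w.1.1 v.1.1 v'.1.1 := by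
    simp [bracket, prolong, liouville]
  unfold canonicalTwoSection dOne
  rw [key, key, hb]
  ring

/-! ### Tangent spaces of the first constraint submanifold -/

namespace LieAlgebroid

variable {m n : ℕ} {M : Type*} [TopologicalSpace M]
  [ChartedSpace (EuclideanSpace ℝ (Fin m)) M] [IsManifold (𝓡 m) ∞ M] {E : M → Type*}
  [TopologicalSpace (TotalSpace (EuclideanSpace ℝ (Fin n)) E)]
  [∀ x, AddCommGroup (E x)] [∀ x, Module ℝ (E x)] [∀ x, TopologicalSpace (E x)]
  [FiberBundle (EuclideanSpace ℝ (Fin n)) E] [VectorBundle ℝ (EuclideanSpace ℝ (Fin n)) E]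
  [ContMDiffVectorBundle ∞ (EuclideanSpace ℝ (Fin n)) E (𝓡 m)]

namespace ConstraintChart

variable {A : LieAlgebroid (m := m) (n := n) E} {S : Set A.Adm} {k : ℕ}
  (c : ConstraintChart S k) (L : A.Adm → ℝ)

theorem Ω₀_apply (w : WCoord m n) (v v' : WFibre n) :
    c.Ω₀ w v v' = v'.2.1.1 ⬝ᵥ v.1.1 + v'.2.1.2 ⬝ᵥ v.1.2 - v.2.1.1 ⬝ᵥ v'.1.1
      - v.2.1.2 ⬝ᵥ v'.1.2 + w.2.1.1 ⬝ᵥ c.coords.toChart.struc w.1.1 v.1.1 v'.1.1 :=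
  AlgebroidChart.canonicalTwoSection_apply _ _ _ _

theorem algebroidW_anchor (w : WCoord m n) (v : WFibre n) :
    c.algebroidW.anchor w v = ((c.coords.toChart.anchor w.1.1 v.1.1, v.1.2), v.2) := rfl

variable {L} in
theorem contDiffAt_expr (hL : IsSmooth L) {q : AdmCoord m n} (hq : q ∈ c.dom) :
    ContDiffAt ℝ ∞ (c.coords.expr L) q := by
  refine (hL c.coords).contDiffAt (Filter.mem_of_superset (c.isOpen_dom.mem_nhds hq) ?_)
  exact fun p hp => c.dom_subset p hp

theorem contDiffAt_Φ {q : AdmCoord m n} (hq : q ∈ c.dom) (α : Fin k) :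
    ContDiffAt ℝ ∞ (c.Φ α) q :=
  (c.contDiffOn α).contDiffAt (c.isOpen_dom.mem_nhds hq)

/-- The matrix `(∂Φ^α/∂z^B)` has a right inverse along the constraint submanifold. -/
theorem exists_rightInverse {q : AdmCoord m n} (hq : q ∈ c.dom) (h0 : ∀ α, c.Φ α q = 0) :
    ∃ G : (Fin k → ℝ) →ₗ[ℝ] (Fin n → ℝ), ∀ μ α, ∑ B, dz (c.Φ α) B q * G μ B = μ α := by
  set D : Matrix (Fin k) (Fin n) ℝ := Matrix.of fun α B => dz (c.Φ α) B q with hD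
  have hsurj : Function.Surjective D.mulVecLin := by
    rw [← LinearMap.range_eq_top]
    refine Submodule.eq_top_of_finrank_eq ?_
    have := c.rank_eq q hq h0
    rw [Matrix.rank] at this
    rw [this]; simp
  obtain ⟨G, hG⟩ := D.mulVecLin.exists_rightInverse_of_surjective (LinearMap.range_eq_top.2 hsurj)
  refine ⟨G, fun μ α => ?_⟩
  have := congrFun (LinearMap.congr_fun hG μ) α
  simpa [hD, Matrix.mulVec, dotProduct] using this

/-- With $D=(\partial\Phi^\alpha/\partial z^B)$ and $DG=1$, the hypothesis $\mu^TD=0$ gives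
$\mu\cdot\mu=\mu^TDG\mu=0$. -/
theorem eq_zero_of_sum_mul_dz_eq_zero {q : AdmCoord m n} (hq : q ∈ c.dom)
    (h0 : ∀ α, c.Φ α q = 0) {μ : Fin k → ℝ} (hμ : ∀ B, ∑ α, μ α * dz (c.Φ α) B q = 0) :
    μ = 0 := by
  obtain ⟨G, hG⟩ := c.exists_rightInverse hq h0
  have h : ∑ α, μ α * μ α = 0 := by
    calc ∑ α, μ α * μ α = ∑ α, μ α * ∑ B, dz (c.Φ α) B q * G μ B := by simp only [hG]
      _ = ∑ B, (∑ α, μ α * dz (c.Φ α) B q) * G μ B := by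
        simp only [Finset.mul_sum, Finset.sum_mul, mul_assoc]
        exact Finset.sum_comm
      _ = 0 := by simp [hμ]
  exact dotProduct_self_eq_zero.1 h

variable {c L} in
theorem IsMultiplier.unique {w : WCoord m n} (hq : w.toAdm ∈ c.dom)
    (h0 : ∀ α, c.Φ α w.toAdm = 0) {lam lam' : Fin k → ℝ} (h : c.IsMultiplier L w lam)
    (h' : c.IsMultiplier L w lam') : lam = lam' := by
  rw [← sub_eq_zero]
  refine c.eq_zero_of_sum_mul_dz_eq_zero hq h0 fun B => ?_
  simp only [Pi.sub_apply, sub_mul, Finset.sum_sub_distrib]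
  linarith [h B, h' B]

/-- The linearization at `w`, with multipliers `lam`, of the equations of `W₁`. -/
def IsTangent (w : WCoord m n) (lam : Fin k → ℝ) (u : WCoord m n) (dlam : Fin k → ℝ) : Prop :=
  (∀ α, fderiv ℝ (c.Φ α) w.toAdm u.toAdm = 0) ∧
    ∀ B, u.2.1.2 B - fderiv ℝ (dz (c.coords.expr L) B) w.toAdm u.toAdm +
      ∑ α, (dlam α * dz (c.Φ α) B w.toAdm + lam α * fderiv ℝ (dz (c.Φ α) B) w.toAdm u.toAdm) = 0

variable {c L} in
/-- The multipliers depend smoothly on the point of `W₁`. -/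
theorem contDiffAt_multiplier (hL : IsSmooth L) {γ : ℝ → WCoord m n} (hγ : ContDiffAt ℝ ∞ γ 0)
    (hq : (γ 0).toAdm ∈ c.dom) (h0 : ∀ α, c.Φ α (γ 0).toAdm = 0) {lam : ℝ → Fin k → ℝ}
    (hlam : ∀ᶠ t in nhds 0, c.IsMultiplier L (γ t) (lam t)) (α : Fin k) :
    ContDiffAt ℝ ∞ (fun t => lam t α) 0 := by
  obtain ⟨G, hG⟩ := c.exists_rightInverse hq h0
  have hγ' : ContDiffAt ℝ ∞ (fun t => (γ t).toAdm) 0 := hγ.fst.prodMk hγ.snd.snd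
  have hz : ∀ β B, ContDiffAt ℝ ∞ (fun t => dz (c.Φ β) B (γ t).toAdm) 0 := fun β B =>
    ContDiffAt.comp (g := dz (c.Φ β) B) (0 : ℝ) ((c.contDiffAt_Φ hq β).dz B) hγ'
  have hp : ∀ B, ContDiffAt ℝ ∞
      (fun t => dz (c.coords.expr L) B (γ t).toAdm - (γ t).2.1.2 B) 0 := fun B =>
    (ContDiffAt.comp (g := dz (c.coords.expr L) B) (0 : ℝ)
      ((c.contDiffAt_expr hL hq).dz B) hγ').sub (contDiffAt_pi.1 hγ.snd.fst.snd B)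
  rw [← contMDiffAt_iff_contDiffAt]
  -- Contracting the $n$ multiplier equations with the fixed vectors $G(e_\beta)$ leaves a $k\times
  -- k$ system for the multipliers, whose matrix at $t=0$ is the identity.
  refine ContMDiffAt.of_mulVec_eq (I := 𝓘(ℝ, ℝ)) (y := lam)
    (A := fun t => Matrix.of fun β α => ∑ B, dz (c.Φ α) B (γ t).toAdm * G (Pi.single β 1) B)
    (b := fun t β => ∑ B, (dz (c.coords.expr L) B (γ t).toAdm - (γ t).2.1.2 B) *
      G (Pi.single β 1) B) (fun β α => ?_) (fun β => ?_) ?_ ?_ α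
  · simp only [Matrix.of_apply]
    exact (ContDiffAt.sum fun B _ => (hz α B).mul contDiffAt_const).contMDiffAt
  · exact (ContDiffAt.sum fun B _ => (hp B).mul contDiffAt_const).contMDiffAt
  · have : (Matrix.of fun β α => ∑ B, dz (c.Φ α) B (γ 0).toAdm * G (Pi.single β 1) B) =
        (1 : Matrix (Fin k) (Fin k) ℝ) := by
      ext β α
      simp [hG, Matrix.one_apply, Pi.single_apply, eq_comm]
    rw [this]; simp
  · filter_upwards [hlam] with t ht
    funext β
    simp only [Matrix.mulVec, dotProduct, Matrix.of_apply, Finset.sum_mul]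
    rw [Finset.sum_comm]
    refine Finset.sum_congr rfl fun B _ => ?_
    have h1 : dz (c.coords.expr L) B (γ t).toAdm - (γ t).2.1.2 B =
        ∑ α, lam t α * dz (c.Φ α) B (γ t).toAdm := by linarith [ht B]
    rw [h1, Finset.sum_mul]
    exact Finset.sum_congr rfl fun α _ => by ring

variable {c L} in
-- For a curve in `W₁` the multipliers are smooth in the parameter, so the defining equations can be
-- differentiated. Conversely, a curve in $\Phi=0$ lifts to `W₁` with any prescribed multipliers,
-- since the multiplier equation can be solved for $\bar p$.
theorem mem_velocities_W₁ (hL : IsSmooth L) {w : WCoord m n} (hq : w.toAdm ∈ c.dom)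
    (h0 : ∀ α, c.Φ α w.toAdm = 0) {lam : Fin k → ℝ} (hlam : c.IsMultiplier L w lam)
    (u : WCoord m n) :
    u ∈ velocities (c.W₁ L) w ↔ ∃ dlam, c.IsTangent L w lam u dlam := by
  have hdz : ∀ (f : AdmCoord m n → ℝ), ContDiffAt ℝ ∞ f w.toAdm →
      HasFDerivAt f (fderiv ℝ f w.toAdm) w.toAdm := fun f hf =>
    (hf.differentiableAt (by simp)).hasFDerivAt
  constructor
  · rintro ⟨γ, hγ, rfl, hmem, hd⟩
    have hmul : ∀ t, ∃ lam, γ t ∈ c.W₁ L → c.IsMultiplier L (γ t) lam := fun t => by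
      by_cases h : γ t ∈ c.W₁ L
      · obtain ⟨l, hl⟩ := h.2.2
        exact ⟨l, fun _ => hl⟩
      · exact ⟨0, fun h' => absurd h' h⟩
    choose lamt hlamt using hmul
    have hev : ∀ᶠ t in nhds 0, c.IsMultiplier L (γ t) (lamt t) := hmem.mono fun t ht => hlamt t ht
    have hlam0 : lamt 0 = lam := (hev.self_of_nhds).unique hq h0 hlam
    have hγ' : HasDerivAt (fun t => (γ t).toAdm) u.toAdm 0 := by
      have h2 : HasDerivAt (fun t => (γ t).2) u.2 0 := hd.prod_snd
      exact hd.prod_fst.prodMk h2.prod_snd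
    refine ⟨fun α => deriv (fun t => lamt t α) 0, fun α => ?_, fun B => ?_⟩
    · have h1 : HasDerivAt (fun t => c.Φ α (γ t).toAdm)
          (fderiv ℝ (c.Φ α) (γ 0).toAdm u.toAdm) 0 :=
        (hdz _ (c.contDiffAt_Φ hq α)).comp_hasDerivAt 0 hγ'
      exact h1.unique ((hasDerivAt_const (0 : ℝ) (0 : ℝ)).congr_of_eventuallyEq
        (hmem.mono fun t ht => ht.2.1 α))
    · have hpB : HasDerivAt (fun t => (γ t).2.1.2 B) (u.2.1.2 B) 0 := by
        have h2 : HasDerivAt (fun t => (γ t).2) u.2 0 := hd.prod_snd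
        exact hasDerivAt_pi.1 h2.prod_fst.prod_snd B
      have h1 := (hpB.sub ((hdz _ ((c.contDiffAt_expr hL hq).dz B)).comp_hasDerivAt 0 hγ')).add
        (HasDerivAt.fun_sum (u := Finset.univ) fun α _ =>
          (((contDiffAt_multiplier hL hγ hq h0 hev α).differentiableAt (by simp)).hasDerivAt).mul
            ((hdz _ ((c.contDiffAt_Φ hq α).dz B)).comp_hasDerivAt 0 hγ'))
      have h2 := h1.unique ((hasDerivAt_const (0 : ℝ) (0 : ℝ)).congr_of_eventuallyEq
        (hev.mono fun t ht => ht B))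
      rw [← hlam0]
      exact h2
  · rintro ⟨dlam, hΦ, hp⟩
    obtain ⟨G, hG⟩ := c.exists_rightInverse hq h0
    obtain ⟨γ, hγ, hγ0, hγd, hγe⟩ := exists_curve_in_levelSet (fun α => c.contDiffAt_Φ hq α)
      ((ContinuousLinearMap.inr ℝ (EuclideanSpace ℝ (Fin m) × (Fin n → ℝ)) (Fin n → ℝ)).comp
        (LinearMap.toContinuousLinearMap G))
      (fun μ α => by
        have := fderiv_apply_zero_left (c.Φ α) w.toAdm (G μ)
        simpa [hG] using this) hΦ
    have hfz : ∀ f : AdmCoord m n → ℝ, ContDiffAt ℝ ∞ f w.toAdm →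
        ContDiffAt ℝ ∞ (fun t => f (γ t)) 0 := fun f hf =>
      ContDiffAt.comp (g := f) (0 : ℝ) (hγ0.symm ▸ hf) hγ
    have hfd : ∀ f : AdmCoord m n → ℝ, ContDiffAt ℝ ∞ f w.toAdm →
        HasDerivAt (fun t => f (γ t)) (fderiv ℝ f w.toAdm u.toAdm) 0 := fun f hf =>
      (hdz f hf).comp_hasDerivAt_of_eq (0 : ℝ) hγd hγ0.symm
    have hlc : ∀ α, ContDiffAt ℝ ∞ (fun t : ℝ => lam α + t * dlam α) 0 := fun α =>
      contDiffAt_const.add (contDiffAt_id.mul contDiffAt_const)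
    have hld : ∀ α, HasDerivAt (fun t : ℝ => lam α + t * dlam α) (dlam α) 0 := fun α => by
      simpa using ((hasDerivAt_id (0 : ℝ)).mul_const (dlam α)).const_add (lam α)
    -- $p$ moves linearly, and $\bar p$ is whatever the multiplier equation dictates for
    -- $\lambda+t\dot\lambda$.
    refine ⟨fun t => ((γ t).1, ((fun B => w.2.1.1 B + t * u.2.1.1 B, fun B =>
      dz (c.coords.expr L) B (γ t) - ∑ α, (lam α + t * dlam α) * dz (c.Φ α) B (γ t)),
        (γ t).2)), ?_, ?_, ?_, ?_⟩
    · refine hγ.fst.prodMk ((ContDiffAt.prodMk ?_ ?_).prodMk hγ.snd)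
      · exact contDiffAt_pi.2 fun B => contDiffAt_const.add (contDiffAt_id.mul contDiffAt_const)
      · exact contDiffAt_pi.2 fun B => (hfz _ ((c.contDiffAt_expr hL hq).dz B)).sub
          (ContDiffAt.sum fun α _ => (hlc α).mul (hfz _ ((c.contDiffAt_Φ hq α).dz B)))
    · have hB : (fun B => dz (c.coords.expr L) B w.toAdm - ∑ α, lam α * dz (c.Φ α) B w.toAdm) =
          w.2.1.2 := funext fun B => by linarith [hlam B]
      simp only [hγ0, zero_mul, add_zero, hB]
      rfl
    · have hdom : ∀ᶠ t in nhds 0, γ t ∈ c.dom :=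
        hγ.continuousAt.eventually_mem (c.isOpen_dom.mem_nhds (hγ0.symm ▸ hq))
      filter_upwards [hdom, hγe] with t ht1 ht2
      refine ⟨ht1, fun α => (ht2 α).trans (h0 α), fun α => lam α + t * dlam α, fun B => ?_⟩
      change dz (c.coords.expr L) B (γ t) - ∑ α, (lam α + t * dlam α) * dz (c.Φ α) B (γ t) -
        dz (c.coords.expr L) B (γ t) + ∑ α, (lam α + t * dlam α) * dz (c.Φ α) B (γ t) = 0
      ring
    · have h1 : HasDerivAt (fun t => (γ t).1) u.1 0 := hγd.prod_fst
      have h2 : HasDerivAt (fun t => (γ t).2) u.2.2 0 := hγd.prod_snd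
      refine h1.prodMk ((HasDerivAt.prodMk ?_ ?_).prodMk h2)
      · exact hasDerivAt_pi.2 fun B => by
          simpa using ((hasDerivAt_id (0 : ℝ)).mul_const (u.2.1.1 B)).const_add (w.2.1.1 B)
      · refine hasDerivAt_pi.2 fun B => ?_
        have h3 := (hfd _ ((c.contDiffAt_expr hL hq).dz B)).sub
          (HasDerivAt.fun_sum (u := Finset.univ) fun α _ =>
            (hld α).mul (hfd _ ((c.contDiffAt_Φ hq α).dz B)))
        refine h3.congr_deriv ?_
        simp only [zero_mul, add_zero, hγ0]
        linarith [hp B]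

end ConstraintChart
end LieAlgebroid

/-! ### Nondegeneracy and the bordered matrix -/

namespace LieAlgebroid

variable {m n : ℕ} {M : Type*} [TopologicalSpace M]
  [ChartedSpace (EuclideanSpace ℝ (Fin m)) M] [IsManifold (𝓡 m) ∞ M] {E : M → Type*}
  [TopologicalSpace (TotalSpace (EuclideanSpace ℝ (Fin n)) E)]
  [∀ x, AddCommGroup (E x)] [∀ x, Module ℝ (E x)] [∀ x, TopologicalSpace (E x)]
  [FiberBundle (EuclideanSpace ℝ (Fin n)) E] [VectorBundle ℝ (EuclideanSpace ℝ (Fin n)) E]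
  [ContMDiffVectorBundle ∞ (EuclideanSpace ℝ (Fin n)) E (𝓡 m)]

namespace ConstraintChart

variable {A : LieAlgebroid (m := m) (n := n) E} {S : Set A.Adm} {k : ℕ}
  (c : ConstraintChart S k) (L : A.Adm → ℝ)

variable {L} in
-- Symmetry of second derivatives turns row $B$ of the Hessian block into the derivative of
-- $\partial/\partial z^B$ along $(0,Z)$, the form in which it appears in `IsTangent`.
theorem borderedMatrix_mulVec_inl (hL : IsSmooth L) {q : AdmCoord m n} (hq : q ∈ c.dom)
    (lam : Fin k → ℝ) (Z : Fin n → ℝ) (μ : Fin k → ℝ) (B : Fin n) :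
    (c.borderedMatrix L q lam *ᵥ Sum.elim Z μ) (Sum.inl B) =
      fderiv ℝ (dz (c.coords.expr L) B) q (0, Z) +
        ∑ α, lam α * fderiv ℝ (dz (c.Φ α) B) q (0, Z) + ∑ α, μ α * dz (c.Φ α) B q := by
  simp only [borderedMatrix, Matrix.mulVec, dotProduct, Fintype.sum_sum_type,
    Matrix.fromBlocks_apply₁₁, Matrix.fromBlocks_apply₁₂, Matrix.of_apply, Sum.elim_inl,
    Sum.elim_inr, fderiv_apply_zero_left]
  congr 1
  · simp only [add_mul, Finset.sum_add_distrib, Finset.sum_mul, Finset.mul_sum]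
    congr 1
    · exact Finset.sum_congr rfl fun C _ => by rw [dz_dz_comm (c.contDiffAt_expr hL hq)]
    · rw [Finset.sum_comm]
      refine Finset.sum_congr rfl fun α _ => Finset.sum_congr rfl fun C _ => ?_
      rw [dz_dz_comm (c.contDiffAt_Φ hq α), mul_assoc]
  · exact Finset.sum_congr rfl fun α _ => mul_comm _ _

theorem borderedMatrix_mulVec_inr (q : AdmCoord m n) (lam : Fin k → ℝ) (Z : Fin n → ℝ)
    (μ : Fin k → ℝ) (α : Fin k) :
    (c.borderedMatrix L q lam *ᵥ Sum.elim Z μ) (Sum.inr α) = fderiv ℝ (c.Φ α) q (0, Z) := by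
  simp [borderedMatrix, Matrix.mulVec, dotProduct, fderiv_apply_zero_left]

/-- Every value of the multipliers occurs over every point of the constraint submanifold. -/
theorem exists_mem_W₁_of_multiplier {w : WCoord m n} (hw : w ∈ c.W₁ L) (lam : Fin k → ℝ) :
    ∃ w' ∈ c.W₁ L, w'.toAdm = w.toAdm ∧ c.IsMultiplier L w' lam := by
  set w' : WCoord m n := (w.1, ((w.2.1.1, fun B => dz (c.coords.expr L) B w.toAdm -
    ∑ α, lam α * dz (c.Φ α) B w.toAdm), w.2.2)) with hw'
  have h : c.IsMultiplier L w' lam := fun B => by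
    change dz (c.coords.expr L) B w.toAdm - ∑ α, lam α * dz (c.Φ α) B w.toAdm -
      dz (c.coords.expr L) B w.toAdm + ∑ α, lam α * dz (c.Φ α) B w.toAdm = 0
    ring
  exact ⟨w', ⟨hw.1, hw.2.1, lam, h⟩, rfl, h⟩

variable {c L} in
theorem mem_restrict_W₁ (hL : IsSmooth L) {w : WCoord m n} (hw : w ∈ c.W₁ L)
    {lam : Fin k → ℝ} (hlam : c.IsMultiplier L w lam) (v : WFibre n) :
    v ∈ c.algebroidW.restrict (c.W₁ L) w ↔ ∃ dlam,
      c.IsTangent L w lam ((c.coords.toChart.anchor w.1.1 v.1.1, v.1.2), v.2) dlam :=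
  mem_velocities_W₁ hL hw.1 hw.2.1 hlam _

variable {c L} in
-- This is where the matrix enters. Solving the linearized multiplier equation for $\bar P$ puts a
-- minus sign on $\lambda$ and $\dot\lambda$.
theorem isTangent_vertical (hL : IsSmooth L) {w : WCoord m n} (hq : w.toAdm ∈ c.dom)
    {lam : Fin k → ℝ} {P Pb Z : Fin n → ℝ} {dlam : Fin k → ℝ} :
    c.IsTangent L w lam ((0, 0), ((P, Pb), Z)) dlam ↔
      c.borderedMatrix L w.toAdm (-lam) *ᵥ Sum.elim Z (-dlam) = Sum.elim Pb 0 := by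
  have hu : WCoord.toAdm (((0, 0), ((P, Pb), Z)) : WCoord m n) = (0, Z) := rfl
  constructor
  · rintro ⟨h1, h2⟩
    funext i
    rcases i with B | α
    · rw [c.borderedMatrix_mulVec_inl hL hq]
      have := h2 B
      simp only [hu, Finset.sum_add_distrib] at this
      simp only [Pi.neg_apply, neg_mul, Finset.sum_neg_distrib, Sum.elim_inl]
      linarith
    · rw [borderedMatrix_mulVec_inr]
      exact h1 α
  · intro h
    refine ⟨fun α => ?_, fun B => ?_⟩
    · have := congrFun h (Sum.inr α)
      rw [borderedMatrix_mulVec_inr] at this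
      exact this
    · have := congrFun h (Sum.inl B)
      rw [c.borderedMatrix_mulVec_inl hL hq] at this
      simp only [Pi.neg_apply, neg_mul, Finset.sum_neg_distrib, Sum.elim_inl] at this
      simp only [hu, Finset.sum_add_distrib]
      linarith

variable {c L} in
/-- The pullback of `Ω_{W₀}` to `W₁` is nondegenerate if the bordered matrix is. -/
theorem IsRegular.nondegenerate (hL : IsSmooth L) (hreg : c.IsRegular L) {w : WCoord m n}
    (hw : w ∈ c.W₁ L) {v : WFibre n} (hv : v ∈ c.algebroidW.restrict (c.W₁ L) w)
    (hΩ : ∀ v' ∈ c.algebroidW.restrict (c.W₁ L) w, c.Ω₀ w v v' = 0) : v = 0 := by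
  obtain ⟨lam, hlam⟩ := hw.2.2
  obtain ⟨dlam, htan⟩ := (mem_restrict_W₁ hL hw hlam v).1 hv
  -- Tangency at `w` involves the matrix at `-lam`; regularity supplies it at another point of `W₁`
  -- with the same $(x,y,z)$.
  obtain ⟨w', hw', hww', hlam'⟩ := c.exists_mem_W₁_of_multiplier L hw (-lam)
  have hM := hreg w' hw' _ hlam'
  rw [hww'] at hM
  obtain ⟨⟨a, b⟩, ⟨⟨P, Pb⟩, Z⟩⟩ := v
  have hvert : ∀ P' Pb' Z' : Fin n → ℝ, ∀ μ,
      c.borderedMatrix L w.toAdm (-lam) *ᵥ Sum.elim Z' (-μ) = Sum.elim Pb' 0 →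
        P' ⬝ᵥ a + Pb' ⬝ᵥ b = 0 := fun P' Pb' Z' μ h => by
    have h1 := hΩ ((0, 0), ((P', Pb'), Z')) ((mem_restrict_W₁ hL hw hlam _).2 ⟨μ, by
      simpa using (isTangent_vertical hL hw.1).2 h⟩)
    simpa [Ω₀_apply] using h1
  have ha : a = 0 := by
    -- $P'=a$ gives $a\cdot a=0$.
    have := hvert a 0 0 0 (by simp)
    simpa using this
  have hb : b = 0 := by
    have hsurj : Function.Surjective (c.borderedMatrix L w.toAdm (-lam)).mulVec :=
      Matrix.mulVec_surjective_iff_isUnit.2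
        ((Matrix.isUnit_iff_isUnit_det _).2 (isUnit_iff_ne_zero.2 hM.det_ne_zero))
    -- Surjectivity makes $\bar P'=b$ attainable, whence $b\cdot b=0$.
    obtain ⟨s, hs⟩ := hsurj (Sum.elim b 0)
    have := hvert 0 b (s ∘ Sum.inl) (-(s ∘ Sum.inr)) (by
      rw [neg_neg, Sum.elim_comp_inl_inr]; exact hs)
    simpa using this
  subst ha hb
  have hP : ∀ a' b' : Fin n → ℝ, P ⬝ᵥ a' + Pb ⬝ᵥ b' = 0 := fun a' b' => by
    obtain ⟨G, hG⟩ := c.exists_rightInverse hw.1 hw.2.1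
    set e : EuclideanSpace ℝ (Fin m) × (Fin n → ℝ) := (c.coords.toChart.anchor w.1.1 a', b')
      with he
    -- The lift of $(a',b')$: $Z'$ restores tangency to $\Phi=0$, and $\bar P'$ is then read off the
    -- linearized equation with $\dot\lambda=0$.
    set Z' : Fin n → ℝ := -G fun α => fderiv ℝ (c.Φ α) w.toAdm (e, 0) with hZ'
    have hmem := (mem_restrict_W₁ hL hw hlam ((a', b'), ((0, fun B =>
        fderiv ℝ (dz (c.coords.expr L) B) w.toAdm (e, Z') -
          ∑ α, lam α * fderiv ℝ (dz (c.Φ α) B) w.toAdm (e, Z')), Z'))).2 ⟨0, fun α => ?_,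
      fun B => by simp [WCoord.toAdm, he]⟩
    · have := hΩ _ hmem
      simp only [Ω₀_apply, map_zero, dotProduct_zero, LinearMap.zero_apply] at this
      linarith
    · change fderiv ℝ (c.Φ α) w.toAdm (e, Z') = 0
      have hsplit : ((e, Z') : AdmCoord m n) = (e, 0) + (0, Z') := by simp
      rw [hsplit, map_add, fderiv_apply_zero_left]
      simp only [hZ', Pi.neg_apply, mul_neg, Finset.sum_neg_distrib, hG]
      ring
  have hP0 : P = 0 := by simpa using hP P 0
  have hPb0 : Pb = 0 := by simpa using hP 0 Pb
  subst hP0 hPb0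
  have h1 := (isTangent_vertical (P := 0) (Pb := 0) (Z := Z) (dlam := dlam) hL hw.1).1
    (by simpa using htan)
  have h2 := hM.separatingRight.eq_zero_of_mulVec_eq_zero (h1.trans (by simp))
  have hZ : Z = 0 := funext fun B => congrFun h2 (Sum.inl B)
  simp [hZ]

variable {c L} in
-- $\Omega_{W_0}$ does not involve $Z$, so a tangent vector with only a $Z$ component is in the
-- kernel of the form. Kernel vectors of the matrix produce such tangent vectors.
theorem isRegular_of_nondegenerate (hL : IsSmooth L)
    (h : ∀ w ∈ c.W₁ L, ∀ v ∈ c.algebroidW.restrict (c.W₁ L) w,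
      (∀ v' ∈ c.algebroidW.restrict (c.W₁ L) w, c.Ω₀ w v v' = 0) → v = 0) :
    c.IsRegular L := by
  intro w hw lam _
  rw [Matrix.nondegenerate_iff_separatingRight,
    Matrix.separatingRight_iff_forall_mulVec_eq_zero]
  intro s hs
  -- At multiplier `-lam` the tangency condition is governed by the matrix at `lam`.
  obtain ⟨w', hw', hww', hlam'⟩ := c.exists_mem_W₁_of_multiplier L hw (-lam)
  rw [← Sum.elim_comp_inl_inr s] at hs ⊢
  set Z := s ∘ Sum.inl
  set μ := s ∘ Sum.inr
  have htan : c.IsTangent L w' (-lam) ((0, 0), ((0, 0), Z)) (-μ) := by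
    rw [isTangent_vertical hL hw'.1, hww', neg_neg, neg_neg, hs]
    simp
  have hZ : Z = 0 := by
    have := h w' hw' ((0, 0), ((0, 0), Z))
      ((mem_restrict_W₁ hL hw' hlam' _).2 ⟨-μ, by simpa using htan⟩)
      (fun v' _ => by simp [Ω₀_apply])
    exact congrArg (fun v : WFibre n => v.2.2) this
  have hμ : μ = 0 := by
    refine c.eq_zero_of_sum_mul_dz_eq_zero hw.1 hw.2.1 fun B => ?_
    have := congrFun hs (Sum.inl B)
    rw [c.borderedMatrix_mulVec_inl hL hw.1, hZ] at this
    simpa [fderiv_apply_zero_left] using this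
  rw [hZ, hμ]
  simp

end ConstraintChart
end LieAlgebroid

/-! ### Locality of the bracket and the Jacobi identity for the structure functions -/

/-- A function smooth near a point agrees near that point with a globally smooth function. -/
theorem ContMDiffOn.exists_contMDiff_eventuallyEq {F H M : Type*} [NormedAddCommGroup F]
    [NormedSpace ℝ F] [FiniteDimensional ℝ F] [TopologicalSpace H] {I : ModelWithCorners ℝ F H}
    [TopologicalSpace M] [ChartedSpace H M] [IsManifold I ∞ M] [T2Space M] {u : Set M} {g : M → ℝ}
    (hg : ContMDiffOn I 𝓘(ℝ, ℝ) ∞ g u) (hu : IsOpen u) {x : M} (hx : x ∈ u) :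
    ∃ f : M → ℝ, ContMDiff I 𝓘(ℝ, ℝ) ∞ f ∧ f =ᶠ[nhds x] g := by
  obtain ⟨φ, hφ, -⟩ := (SmoothBumpFunction.nhds_basis_support (I := I) (hu.mem_nhds hx)).mem_iff.1
    (hu.mem_nhds hx)
  refine ⟨fun y => φ y * g y, contMDiff_of_tsupport fun y hy => ?_, ?_⟩
  · have hyu : y ∈ u := hφ (tsupport_mul_subset_left hy)
    exact φ.contMDiffAt.mul ((hg y hyu).contMDiffAt (hu.mem_nhds hyu))
  · filter_upwards [φ.eventuallyEq_one] with y hy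
    simp [hy]

theorem ContMDiffSection.sum_apply {𝕜 F H M G : Type*} [NontriviallyNormedField 𝕜]
    [NormedAddCommGroup F] [NormedSpace 𝕜 F] [TopologicalSpace H] {I : ModelWithCorners 𝕜 F H}
    [TopologicalSpace M] [ChartedSpace H M] [NormedAddCommGroup G] [NormedSpace 𝕜 G] {r : ℕ∞ω}
    {V : M → Type*} [TopologicalSpace (TotalSpace G V)] [∀ x, AddCommGroup (V x)]
    [∀ x, Module 𝕜 (V x)] [∀ x, TopologicalSpace (V x)] [FiberBundle G V] [VectorBundle 𝕜 G V]
    {ι : Type*} (s : Finset ι) (W : ι → Cₛ^r⟮I; G, V⟯) (x : M) :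
    (∑ i ∈ s, W i) x = ∑ i ∈ s, W i x :=
  (congrFun (map_sum (ContMDiffSection.coeAddHom I G r V) W s) x).trans (Finset.sum_apply _ _ _)

namespace LieAlgebroid

variable {m n : ℕ} {M : Type*} [TopologicalSpace M]
  [ChartedSpace (EuclideanSpace ℝ (Fin m)) M] [IsManifold (𝓡 m) ∞ M] {E : M → Type*}
  [TopologicalSpace (TotalSpace (EuclideanSpace ℝ (Fin n)) E)]
  [∀ x, AddCommGroup (E x)] [∀ x, Module ℝ (E x)] [∀ x, TopologicalSpace (E x)]
  [FiberBundle (EuclideanSpace ℝ (Fin n)) E] [VectorBundle ℝ (EuclideanSpace ℝ (Fin n)) E]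

section Bracket

variable (A : LieAlgebroid (m := m) (n := n) E)

theorem bracket_antisymm (X Y : Cₛ^∞⟮𝓡 m; EuclideanSpace ℝ (Fin n), E⟯) :
    A.bracket X Y = -A.bracket Y X := by
  have h := A.bracket_self (X + Y)
  simp only [map_add, LinearMap.add_apply, A.bracket_self, zero_add, add_zero] at h
  exact eq_neg_of_add_eq_zero_right h

/-- The bracket is a local operator. -/
theorem bracket_congr [T2Space M] (X : Cₛ^∞⟮𝓡 m; EuclideanSpace ℝ (Fin n), E⟯)
    {Y Y' : Cₛ^∞⟮𝓡 m; EuclideanSpace ℝ (Fin n), E⟯} {x : M} (h : ∀ᶠ y in nhds x, Y y = Y' y) :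
    A.bracket X Y x = A.bracket X Y' x := by
  obtain ⟨φ, hφ, -⟩ := (SmoothBumpFunction.nhds_basis_support (I := 𝓡 m) h).mem_iff.1 h
  -- The bump function $\varphi$ is supported where $Y=Y'$, so $\varphi(Y-Y')=0$; the Leibniz rule
  -- at $x$, where $\varphi=1$ and $Y-Y'=0$, then isolates the bracket.
  have hz : ∀ y, (0 : Cₛ^∞⟮𝓡 m; EuclideanSpace ℝ (Fin n), E⟯) y = φ y • (Y - Y') y := fun y => by
    by_cases hy : Y y = Y' y
    · simp [hy]
    · have : φ y = 0 := by
        by_contra h0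
        exact hy (hφ (subset_tsupport _ h0))
      simp [this]
  have h1 := A.leibniz φ φ.contMDiff X (Y - Y') 0 hz x
  have h2 : (Y - Y') x = 0 := by simp [h.self_of_nhds]
  rw [h2, smul_zero, add_zero, φ.eq_one, one_smul, map_zero, map_sub] at h1
  have h3 : A.bracket X Y x - A.bracket X Y' x = 0 := by simpa using h1.symm
  exact sub_eq_zero.1 h3

/-- The Leibniz rule for a section which is locally a combination of given sections. -/
theorem bracket_of_eventually_eq_sum [T2Space M] {ι : Type*} [Fintype ι]
    (X Y : Cₛ^∞⟮𝓡 m; EuclideanSpace ℝ (Fin n), E⟯)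
    (e : ι → Cₛ^∞⟮𝓡 m; EuclideanSpace ℝ (Fin n), E⟯) {f : ι → M → ℝ}
    (hf : ∀ i, ContMDiff (𝓡 m) 𝓘(ℝ, ℝ) ∞ (f i)) {x : M}
    (h : ∀ᶠ y in nhds x, Y y = ∑ i, f i y • e i y) :
    A.bracket X Y x = ∑ i, (f i x • A.bracket X (e i) x +
      (show ℝ from mfderiv (𝓡 m) 𝓘(ℝ, ℝ) (f i) x (A.anchor x (X x))) • e i x) := by
  set Z : ι → Cₛ^∞⟮𝓡 m; EuclideanSpace ℝ (Fin n), E⟯ := fun i =>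
    ⟨fun y => f i y • e i y, (hf i).smul_section (e i).contMDiff⟩ with hZ
  have h1 : A.bracket X Y x = A.bracket X (∑ i, Z i) x :=
    A.bracket_congr X (h.mono fun y hy => by rw [ContMDiffSection.sum_apply]; exact hy)
  rw [h1, map_sum, ContMDiffSection.sum_apply]
  exact Finset.sum_congr rfl fun i _ => A.leibniz (f i) (hf i) X (e i) (Z i) (fun _ => rfl) x

end Bracket

namespace LocalCoordinates

variable {A : LieAlgebroid (m := m) (n := n) E} (κ : A.LocalCoordinates)

/-- The components of a smooth section in the frame are smooth. -/
theorem contMDiffOn_coeff (Y : Cₛ^∞⟮𝓡 m; EuclideanSpace ℝ (Fin n), E⟯) (l : Fin n) :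
    ContMDiffOn (𝓡 m) 𝓘(ℝ, ℝ) ∞ (fun x => κ.isLocalFrameOn.coeff l x (Y x)) κ.chart.source := by
  intro x hx
  refine ContMDiffAt.contMDiffWithinAt ?_
  set e := trivializationAt (EuclideanSpace ℝ (Fin n)) E x with he
  have hxe : x ∈ e.baseSet := mem_baseSet_trivializationAt _ _ _
  have hsm : ∀ (W : Cₛ^∞⟮𝓡 m; EuclideanSpace ℝ (Fin n), E⟯) (a : Fin n),
      ContMDiffAt (𝓡 m) 𝓘(ℝ, ℝ) ∞ (fun t => (e ⟨t, W t⟩).2 a) x := fun W a => by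
    have h1 := (Bundle.contMDiffAt_section (IB := 𝓡 m) (n := ∞) (s := fun y => W y) x).1
      (W.contMDiff x)
    exact ContMDiffAt.comp x (I' := 𝓘(ℝ, EuclideanSpace ℝ (Fin n)))
      (g := fun v : EuclideanSpace ℝ (Fin n) => v a)
      (ContDiff.contMDiff (by fun_prop)).contMDiffAt h1
  -- In a trivialization the components solve a linear system whose columns are the frame,
  -- invertible because the frame is independent.
  refine ContMDiffAt.of_mulVec_eq (A := fun t => Matrix.of fun a i => (e ⟨t, κ.frame i t⟩).2 a)
    (b := fun t a => (e ⟨t, Y t⟩).2 a)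
    (y := fun t l => κ.isLocalFrameOn.coeff l t (Y t))
    (fun a i => hsm (κ.frame i) a) (fun a => hsm Y a) ?_ ?_ l
  · have hli := (κ.isLocalFrameOn.linearIndependent hx).map'
      ((WithLp.linearEquiv 2 ℝ (Fin n → ℝ)).toLinearMap ∘ₗ (e.linearEquivAt ℝ x hxe).toLinearMap)
      (LinearMap.ker_eq_bot.2 (by
        exact (WithLp.linearEquiv 2 ℝ (Fin n → ℝ)).injective.comp
          (e.linearEquivAt ℝ x hxe).injective))
    refine isUnit_iff_ne_zero.1 ((Matrix.isUnit_iff_isUnit_det _).1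
      (Matrix.linearIndependent_cols_iff_isUnit.1 ?_))
    exact hli
  · filter_upwards [κ.chart.open_source.mem_nhds hx, e.open_baseSet.mem_nhds hxe] with t ht hte
    funext a
    have h1 : (e ⟨t, Y t⟩).2 =
        ∑ i, κ.isLocalFrameOn.coeff i t (Y t) • (e ⟨t, κ.frame i t⟩).2 := by
      have h2 := congrArg (e.linearEquivAt ℝ t hte)
        (κ.isLocalFrameOn.coeff_sum_eq (fun y => Y y) ht)
      rw [map_sum] at h2
      simpa only [map_smul, Trivialization.linearEquivAt_apply] using h2
    rw [h1]
    simp [Matrix.mulVec, dotProduct, mul_comm]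

/-- The section with constant components `a`. -/
noncomputable def constSection (a : Fin n → ℝ) : Cₛ^∞⟮𝓡 m; EuclideanSpace ℝ (Fin n), E⟯ :=
  ∑ i, a i • κ.frame i

theorem constSection_apply (a : Fin n → ℝ) (x : M) :
    κ.constSection a x = ∑ i, a i • κ.frame i x := by
  simp [constSection, ContMDiffSection.sum_apply]

/-- Bilinearity over ℝ extends the definition from the frame to all constant components, so
antisymmetry, smoothness and Jacobi can be read off the bracket of global sections. -/
theorem toChart_struc_apply (u : EuclideanSpace ℝ (Fin m)) (a a' : Fin n → ℝ) (l : Fin n) :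
    κ.toChart.struc u a a' l = κ.isLocalFrameOn.coeff l (κ.chart.symm u)
      (A.bracket (κ.constSection a) (κ.constSection a') (κ.chart.symm u)) := by
  have hb : A.bracket (κ.constSection a) (κ.constSection a') =
      ∑ i, ∑ j, (a i * a' j) • A.bracket (κ.frame i) (κ.frame j) := by
    simp only [constSection, map_sum, LinearMap.sum_apply, map_smul, LinearMap.smul_apply,
      Finset.smul_sum, smul_smul]
    rw [Finset.sum_comm]
    simp only [mul_comm]
  rw [hb]
  simp [toChart, ContMDiffSection.sum_apply]

theorem toChart_struc_antisymm (u : EuclideanSpace ℝ (Fin m)) (a a' : Fin n → ℝ) :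
    κ.toChart.struc u a a' = -κ.toChart.struc u a' a := by
  funext l
  rw [Pi.neg_apply, toChart_struc_apply, toChart_struc_apply, A.bracket_antisymm]
  simp

theorem differentiableAt_toChart_struc {u : EuclideanSpace ℝ (Fin m)} (hu : u ∈ κ.chart.target)
    (a a' : Fin n → ℝ) : DifferentiableAt ℝ (fun v => κ.toChart.struc v a a') u := by
  refine differentiableAt_pi.2 fun l => ?_
  simp only [toChart_struc_apply]
  have h1 := (κ.contMDiffOn_coeff (A.bracket (κ.constSection a) (κ.constSection a')) l).contMDiffAt
    (κ.chart.open_source.mem_nhds (κ.chart.map_target hu))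
  have h2 := (contMDiffOn_symm_of_mem_maximalAtlas κ.chart_mem).contMDiffAt
    (κ.chart.open_target.mem_nhds hu)
  have h3 := (ContMDiffAt.comp u h1 h2).contDiffAt
  exact h3.differentiableAt (by simp)

theorem toChart_anchor_apply (u : EuclideanSpace ℝ (Fin m)) (a : Fin n → ℝ) :
    κ.toChart.anchor u a =
      (show EuclideanSpace ℝ (Fin m) from mfderiv (𝓡 m) (𝓡 m) κ.chart (κ.chart.symm u)
        (A.anchor (κ.chart.symm u) (κ.constSection a (κ.chart.symm u)))) := by
  rw [constSection_apply]
  simp only [toChart, map_sum, map_smul]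
  rfl

/-- The derivative of a function along the anchor, in coordinates. -/
theorem mfderiv_anchor_constSection {f : M → ℝ} (hf : ContMDiff (𝓡 m) 𝓘(ℝ, ℝ) ∞ f)
    {u : EuclideanSpace ℝ (Fin m)} (hu : u ∈ κ.chart.target) (a : Fin n → ℝ) :
    (show ℝ from mfderiv (𝓡 m) 𝓘(ℝ, ℝ) f (κ.chart.symm u)
      (A.anchor (κ.chart.symm u) (κ.constSection a (κ.chart.symm u)))) =
      fderiv ℝ (f ∘ κ.chart.symm) u (κ.toChart.anchor u a) := by
  have hx := κ.chart.map_target hu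
  have hch : MDifferentiableAt (𝓡 m) (𝓡 m) κ.chart (κ.chart.symm u) :=
    ((contMDiffOn_of_mem_maximalAtlas κ.chart_mem).contMDiffAt
      (κ.chart.open_source.mem_nhds hx)).mdifferentiableAt (by simp)
  have hsymm := (contMDiffOn_symm_of_mem_maximalAtlas κ.chart_mem).contMDiffAt
    (κ.chart.open_target.mem_nhds hu)
  have hg : MDifferentiableAt (𝓡 m) 𝓘(ℝ, ℝ) (f ∘ κ.chart.symm) u :=
    (ContMDiffAt.comp u hf.contMDiffAt hsymm).mdifferentiableAt (by simp)
  have heq : f =ᶠ[nhds (κ.chart.symm u)] (f ∘ κ.chart.symm) ∘ κ.chart := by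
    filter_upwards [κ.chart.open_source.mem_nhds hx] with y hy
    simp [κ.chart.left_inv hy]
  have hc := mfderiv_comp_apply_of_eq (κ.chart.symm u) hg hch (κ.chart.right_inv hu)
    (A.anchor (κ.chart.symm u) (κ.constSection a (κ.chart.symm u)))
  rw [heq.mfderiv_eq, toChart_anchor_apply]
  refine hc.trans ?_
  rw [κ.chart.right_inv hu, mfderiv_eq_fderiv]
  rfl

theorem toChart_struc_single (u : EuclideanSpace ℝ (Fin m)) (a : Fin n → ℝ) (r l : Fin n) :
    κ.toChart.struc u a (Pi.single r 1) l = κ.isLocalFrameOn.coeff l (κ.chart.symm u)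
      (A.bracket (κ.constSection a) (κ.frame r) (κ.chart.symm u)) := by
  rw [toChart_struc_apply]
  have : κ.constSection (Pi.single r 1) = κ.frame r := by
    simp [constSection, Pi.single_apply]
  rw [this]

theorem coeff_frame {x : M} (hx : x ∈ κ.chart.source) (r l : Fin n) :
    κ.isLocalFrameOn.coeff l x (κ.frame r x) = if r = l then 1 else 0 := by
  have h1 := κ.isLocalFrameOn.coeff_apply_of_mem hx (fun y => κ.frame r y) l
  have h2 := κ.isLocalFrameOn.toBasisAt_coe hx r
  rw [h1, ← h2, Module.Basis.repr_self, Finsupp.single_apply]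

/-- The components of an iterated bracket of sections with constant components. -/
theorem coeff_bracket_bracket [T2Space M] {u : EuclideanSpace ℝ (Fin m)}
    (hu : u ∈ κ.chart.target) (a₁ a₂ a₃ : Fin n → ℝ) (l : Fin n) :
    κ.isLocalFrameOn.coeff l (κ.chart.symm u) (A.bracket (κ.constSection a₁)
      (A.bracket (κ.constSection a₂) (κ.constSection a₃)) (κ.chart.symm u)) =
    κ.toChart.struc u a₁ (κ.toChart.struc u a₂ a₃) l +
      fderiv ℝ (fun v => κ.toChart.struc v a₂ a₃) u (κ.toChart.anchor u a₁) l := by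
  have hx := κ.chart.map_target hu
  set Y := A.bracket (κ.constSection a₂) (κ.constSection a₃) with hY
  -- The components of the inner bracket are smooth only over the chart, while the Leibniz rule
  -- needs global functions; by locality, extensions agreeing near the point suffice.
  choose f hf hfe using fun r => (κ.contMDiffOn_coeff Y r).exists_contMDiff_eventuallyEq
    κ.chart.open_source hx
  have hfx : ∀ r, f r (κ.chart.symm u) = κ.toChart.struc u a₂ a₃ r := fun r => by
    rw [(hfe r).eq_of_nhds, toChart_struc_apply]
  have hsum : ∀ᶠ y in nhds (κ.chart.symm u), Y y = ∑ r, f r y • κ.frame r y := by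
    filter_upwards [κ.chart.open_source.mem_nhds hx, Filter.eventually_all.2 hfe] with y hy h
    simp only [h]
    exact κ.isLocalFrameOn.coeff_sum_eq (fun y => Y y) hy
  have hder : ∀ r, fderiv ℝ (f r ∘ κ.chart.symm) u (κ.toChart.anchor u a₁) =
      fderiv ℝ (fun v => κ.toChart.struc v a₂ a₃) u (κ.toChart.anchor u a₁) r := fun r => by
    have h1 : (f r ∘ κ.chart.symm) =ᶠ[nhds u] fun v => κ.toChart.struc v a₂ a₃ r := by
      filter_upwards [(κ.chart.continuousAt_symm hu).eventually (hfe r)] with v hv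
      simp only [toChart_struc_apply, Function.comp_apply, hv, hY]
    rw [h1.fderiv_eq, (hasFDerivAt_pi'.1
      (κ.differentiableAt_toChart_struc hu a₂ a₃).hasFDerivAt r).fderiv]
    rfl
  rw [A.bracket_of_eventually_eq_sum (κ.constSection a₁) Y κ.frame hf hsum, map_sum]
  simp only [map_add, map_smul, smul_eq_mul, Finset.sum_add_distrib, coeff_frame κ hx, hfx,
    ← toChart_struc_single, κ.mfderiv_anchor_constSection (hf _) hu, hder]
  congr 1
  · have h2 : κ.toChart.struc u a₂ a₃ =
        ∑ r, κ.toChart.struc u a₂ a₃ r • (Pi.single r 1 : Fin n → ℝ) := by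
      funext j; simp [Finset.sum_apply, Pi.single_apply]
    conv_rhs => rw [h2, map_sum, Finset.sum_apply]
    simp
  · simp

/-- The Jacobi identity for the structure functions. -/
theorem toChart_jacobi [T2Space M] {u : EuclideanSpace ℝ (Fin m)}
    (hu : u ∈ κ.chart.target) (a₁ a₂ a₃ : Fin n → ℝ) :
    (κ.toChart.struc u a₁ (κ.toChart.struc u a₂ a₃) +
        fderiv ℝ (fun v => κ.toChart.struc v a₂ a₃) u (κ.toChart.anchor u a₁)) +
      (κ.toChart.struc u a₃ (κ.toChart.struc u a₁ a₂) +
        fderiv ℝ (fun v => κ.toChart.struc v a₁ a₂) u (κ.toChart.anchor u a₃)) +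
      (κ.toChart.struc u a₂ (κ.toChart.struc u a₃ a₁) +
        fderiv ℝ (fun v => κ.toChart.struc v a₃ a₁) u (κ.toChart.anchor u a₂)) = 0 := by
  funext l
  have h := congrArg (fun W : Cₛ^∞⟮𝓡 m; EuclideanSpace ℝ (Fin n), E⟯ =>
    κ.isLocalFrameOn.coeff l (κ.chart.symm u) (W (κ.chart.symm u)))
    (A.jacobi (κ.constSection a₁) (κ.constSection a₂) (κ.constSection a₃))
  simp only [ContMDiffSection.coe_add, Pi.add_apply, map_add, coeff_bracket_bracket κ hu,
    ContMDiffSection.coe_zero, Pi.zero_apply, map_zero] at h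
  exact h

end LocalCoordinates
end LieAlgebroid

/-! ### Tensoriality of the differential -/

namespace AlgebroidChart

variable {X V : Type*} [NormedAddCommGroup X] [NormedSpace ℝ X]
  [NormedAddCommGroup V] [NormedSpace ℝ V]

/-- The product rule for a family of bilinear forms. -/
theorem fderiv_bilin_apply [FiniteDimensional ℝ V] {Ω : X → V →ₗ[ℝ] V →ₗ[ℝ] ℝ} {x : X}
    (hΩ : ∀ v v', DifferentiableAt ℝ (fun y => Ω y v v') x) {σ τ : X → V}
    (hσ : DifferentiableAt ℝ σ x) (hτ : DifferentiableAt ℝ τ x) (d : X) :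
    fderiv ℝ (fun y => Ω y (σ y) (τ y)) x d = fderiv ℝ (fun y => Ω y (σ x) (τ x)) x d +
      Ω x (fderiv ℝ σ x d) (τ x) + Ω x (σ x) (fderiv ℝ τ x d) := by
  set b := Module.finBasis ℝ V
  set φ : Fin (Module.finrank ℝ V) → V →L[ℝ] ℝ := fun i =>
    LinearMap.toContinuousLinearMap (b.coord i) with hφ
  -- Differentiability is assumed only for the scalar functions $\Omega(v,v')$, hence the expansion
  -- in a basis.
  have hexp : ∀ y v v', Ω y v v' = ∑ i, ∑ j, Ω y (b i) (b j) * (φ i v * φ j v') := fun y v v' => by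
    conv_lhs => rw [← b.sum_repr v, ← b.sum_repr v']
    simp only [hφ, LinearMap.coe_toContinuousLinearMap', Module.Basis.coord_apply, map_sum,
      map_smul, LinearMap.sum_apply, LinearMap.smul_apply, smul_eq_mul, Finset.mul_sum]
    rw [Finset.sum_comm]
    exact Finset.sum_congr rfl fun i _ => Finset.sum_congr rfl fun j _ => by ring
  have hder : ∀ σ τ : X → V, DifferentiableAt ℝ σ x → DifferentiableAt ℝ τ x →
      fderiv ℝ (fun y => Ω y (σ y) (τ y)) x d = ∑ i, ∑ j,
        (Ω x (b i) (b j) * (φ i (σ x) * φ j (fderiv ℝ τ x d) + φ j (τ x) * φ i (fderiv ℝ σ x d)) +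
          φ i (σ x) * φ j (τ x) * fderiv ℝ (fun y => Ω y (b i) (b j)) x d) :=
    fun σ τ hσ hτ => by
      have hij := fun i j => (hΩ (b i) (b j)).hasFDerivAt.mul
        (((φ i).hasFDerivAt.comp x hσ.hasFDerivAt).mul
          ((φ j).hasFDerivAt.comp x hτ.hasFDerivAt))
      have h := HasFDerivAt.fun_sum (u := Finset.univ) fun i _ =>
        HasFDerivAt.fun_sum (u := Finset.univ) fun j _ => hij i j
      have heq : (fun y => Ω y (σ y) (τ y)) =
          fun y => ∑ i, ∑ j, Ω y (b i) (b j) * (φ i (σ y) * φ j (τ y)) :=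
        funext fun y => hexp y (σ y) (τ y)
      rw [heq]
      refine (congrArg (fun D : X →L[ℝ] ℝ => D d) (HasFDerivAt.fderiv h)).trans ?_
      simp [mul_add]
  rw [hder σ τ hσ hτ, hder _ _ (differentiableAt_const (σ x)) (differentiableAt_const (τ x)),
    hexp x (fderiv ℝ σ x d), hexp x (σ x)]
  simp only [← Finset.sum_add_distrib]
  refine Finset.sum_congr rfl fun i _ => Finset.sum_congr rfl fun j _ => ?_
  simp only [fderiv_fun_const, Pi.zero_apply, zero_apply, map_zero]
  ring

/-- The differential of a 2-section is tensorial. -/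
theorem dTwo_eq_dTwo_const [FiniteDimensional ℝ V] (A : AlgebroidChart X V)
    {Ω : X → V →ₗ[ℝ] V →ₗ[ℝ] ℝ} {x : X} (halt : (Ω x).IsAlt)
    (hΩ : ∀ v v', DifferentiableAt ℝ (fun y => Ω y v v') x) {σ τ υ : X → V}
    (hσ : DifferentiableAt ℝ σ x) (hτ : DifferentiableAt ℝ τ x) (hυ : DifferentiableAt ℝ υ x) :
    A.dTwo (fun y v v' => Ω y v v') σ τ υ x =
      A.dTwo (fun y v v' => Ω y v v') (fun _ => σ x) (fun _ => τ x) (fun _ => υ x) x := by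
  simp only [dTwo, lieDeriv, bracket, fderiv_bilin_apply hΩ hσ hτ, fderiv_bilin_apply hΩ hσ hυ,
    fderiv_bilin_apply hΩ hτ hυ, fderiv_fun_const, Pi.zero_apply, zero_apply,
    map_add, map_sub, LinearMap.add_apply, LinearMap.sub_apply, add_zero, sub_zero]
  -- With every derivative of a section moved to the first slot, the product rule terms cancel those
  -- coming from the brackets.
  have hs : ∀ v v', Ω x v v' = -Ω x v' v := fun v v' => (halt.neg v' v).symm
  rw [hs (σ x) (fderiv ℝ υ x _), hs (σ x) (fderiv ℝ τ x _), hs (τ x) (fderiv ℝ υ x _)]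
  ring

end AlgebroidChart

/-! ### Closedness of $\Omega_{W_0}$ and the equivalence -/

namespace LieAlgebroid

variable {m n : ℕ} {M : Type*} [TopologicalSpace M]
  [ChartedSpace (EuclideanSpace ℝ (Fin m)) M] [IsManifold (𝓡 m) ∞ M] {E : M → Type*}
  [TopologicalSpace (TotalSpace (EuclideanSpace ℝ (Fin n)) E)]
  [∀ x, AddCommGroup (E x)] [∀ x, Module ℝ (E x)] [∀ x, TopologicalSpace (E x)]
  [FiberBundle (EuclideanSpace ℝ (Fin n)) E] [VectorBundle ℝ (EuclideanSpace ℝ (Fin n)) E]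
  [ContMDiffVectorBundle ∞ (EuclideanSpace ℝ (Fin n)) E (𝓡 m)]

namespace ConstraintChart

variable {A : LieAlgebroid (m := m) (n := n) E} {S : Set A.Adm} {k : ℕ}
  (c : ConstraintChart S k) 

/-- `Ω_{W₀}` as a family of bilinear forms. -/
noncomputable def bilinΩ₀ (w : WCoord m n) : WFibre n →ₗ[ℝ] WFibre n →ₗ[ℝ] ℝ :=
  LinearMap.mk₂ ℝ (c.Ω₀ w)
    (fun v₁ v₂ v' => by simp [Ω₀_apply]; ring)
    (fun r v v' => by simp [Ω₀_apply]; ring)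
    (fun v v₁ v₂ => by simp [Ω₀_apply]; ring)
    (fun r v v' => by simp [Ω₀_apply]; ring)

theorem isAlt_bilinΩ₀ (w : WCoord m n) : (c.bilinΩ₀ w).IsAlt := fun v => by
  have h : c.coords.toChart.struc w.1.1 v.1.1 v.1.1 = 0 :=
    self_eq_neg.1 (c.coords.toChart_struc_antisymm w.1.1 v.1.1 v.1.1)
  change c.Ω₀ w v v = 0
  rw [Ω₀_apply, h, dotProduct_zero]
  ring

/-- For fixed fibre vectors only the term $p\cdot C(x)$ varies with the point. -/
theorem hasFDerivAt_Ω₀ {w : WCoord m n} (hw : w.1.1 ∈ c.coords.chart.target) (v v' : WFibre n) :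
    ∃ D : WCoord m n →L[ℝ] ℝ, HasFDerivAt (fun y => c.Ω₀ y v v') D w ∧ ∀ d, D d =
      d.2.1.1 ⬝ᵥ c.coords.toChart.struc w.1.1 v.1.1 v'.1.1 +
        w.2.1.1 ⬝ᵥ fderiv ℝ (fun x => c.coords.toChart.struc x v.1.1 v'.1.1) w.1.1 d.1.1 := by
  set πx : WCoord m n →L[ℝ] EuclideanSpace ℝ (Fin m) :=
    (ContinuousLinearMap.fst ℝ _ _).comp (ContinuousLinearMap.fst ℝ _ _)
  set πp : WCoord m n →L[ℝ] (Fin n → ℝ) := (ContinuousLinearMap.fst ℝ _ _).comp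
    ((ContinuousLinearMap.fst ℝ _ _).comp (ContinuousLinearMap.snd ℝ _ _))
  set C : EuclideanSpace ℝ (Fin m) → Fin n → ℝ :=
    fun x => c.coords.toChart.struc x v.1.1 v'.1.1 with hCdef
  have hC : HasFDerivAt C (fderiv ℝ C w.1.1) w.1.1 :=
    (c.coords.differentiableAt_toChart_struc hw v.1.1 v'.1.1).hasFDerivAt
  have hC' : ∀ l, HasFDerivAt (fun y : WCoord m n => C y.1.1 l)
      ((ContinuousLinearMap.proj l).comp ((fderiv ℝ C w.1.1).comp πx)) w := fun l =>
    hasFDerivAt_pi'.1 (HasFDerivAt.comp w (f := πx) hC πx.hasFDerivAt) l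
  have hp : ∀ l, HasFDerivAt (fun y : WCoord m n => y.2.1.1 l)
      ((ContinuousLinearMap.proj l).comp πp) w := fun l =>
    hasFDerivAt_pi'.1 πp.hasFDerivAt l
  have h := (HasFDerivAt.fun_sum (u := Finset.univ) fun l _ => (hp l).mul (hC' l)).const_add
    (v'.2.1.1 ⬝ᵥ v.1.1 + v'.2.1.2 ⬝ᵥ v.1.2 - v.2.1.1 ⬝ᵥ v'.1.1 - v.2.1.2 ⬝ᵥ v'.1.2)
  refine ⟨_, by simp only [Ω₀_apply, dotProduct]; exact h, fun d => ?_⟩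
  have hx : πx d = d.1.1 := rfl
  have hpd : πp d = d.2.1.1 := rfl
  simp only [dotProduct, ← Finset.sum_add_distrib, sum_apply, add_apply, smul_apply,
    ContinuousLinearMap.comp_apply, ContinuousLinearMap.proj_apply, hx, hpd, smul_eq_mul]
  exact Finset.sum_congr rfl fun l _ => by ring

/-- The section `Ω_{W₀}` is closed. -/
theorem dTwo_Ω₀ [T2Space M] {w : WCoord m n} (hw : w.1.1 ∈ c.coords.chart.target)
    {σ τ υ : WCoord m n → WFibre n} (hσ : DifferentiableAt ℝ σ w) (hτ : DifferentiableAt ℝ τ w)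
    (hυ : DifferentiableAt ℝ υ w) : c.algebroidW.dTwo c.Ω₀ σ τ υ w = 0 := by
  have hd : ∀ v v', DifferentiableAt ℝ (fun y => c.bilinΩ₀ y v v') w := fun v v' => by
    obtain ⟨D, hD, -⟩ := c.hasFDerivAt_Ω₀ hw v v'
    exact hD.differentiableAt
  have hder : ∀ v v' d, fderiv ℝ (fun y => c.Ω₀ y v v') w d =
      d.2.1.1 ⬝ᵥ c.coords.toChart.struc w.1.1 v.1.1 v'.1.1 +
        w.2.1.1 ⬝ᵥ fderiv ℝ (fun x => c.coords.toChart.struc x v.1.1 v'.1.1) w.1.1 d.1.1 :=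
    fun v v' d => by
      obtain ⟨D, hD, hDd⟩ := c.hasFDerivAt_Ω₀ hw v v'
      rw [hD.fderiv, hDd]
  refine (c.algebroidW.dTwo_eq_dTwo_const (c.isAlt_bilinΩ₀ w) hd hσ hτ hυ).trans ?_
  change c.algebroidW.dTwo c.Ω₀ _ _ _ w = 0
  have hbr : ∀ v v' : WFibre n, c.algebroidW.bracket (fun _ => v) (fun _ => v') w =
      ((c.coords.toChart.struc w.1.1 v.1.1 v'.1.1, 0), 0) := fun v v' => by
    simp [AlgebroidChart.bracket, algebroidW, AlgebroidChart.prolong]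
  -- Each derivative yields a term $P\cdot C$, cancelled by the canonical part of $\Omega$ evaluated
  -- on a bracket. What remains is $p$ paired with the Jacobi identity.
  simp only [AlgebroidChart.dTwo, AlgebroidChart.lieDeriv, hbr, hder, algebroidW_anchor]
  simp only [Ω₀_apply, dotProduct_zero, zero_dotProduct, Prod.fst_zero, Prod.snd_zero, add_zero,
    sub_zero]
  generalize (σ w).1.1 = a₁, (τ w).1.1 = a₂, (υ w).1.1 = a₃
  have hJ := congrArg (fun a => w.2.1.1 ⬝ᵥ a) (c.coords.toChart_jacobi hw a₁ a₂ a₃)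
  -- Antisymmetry of $C$, also for its derivative, brings the cyclic Jacobi sum to the argument
  -- order used in `dTwo`.
  have hfd : fderiv ℝ (fun v => c.coords.toChart.struc v a₃ a₁) w.1.1 =
      -fderiv ℝ (fun v => c.coords.toChart.struc v a₁ a₃) w.1.1 := by
    rw [← fderiv_fun_neg]
    simp only [← c.coords.toChart_struc_antisymm _ a₃ a₁]
  rw [hfd, c.coords.toChart_struc_antisymm _ a₃ a₁,
    c.coords.toChart_struc_antisymm _ a₁ (c.coords.toChart.struc w.1.1 a₂ a₃),
    c.coords.toChart_struc_antisymm _ a₃ (c.coords.toChart.struc w.1.1 a₁ a₂),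
    c.coords.toChart_struc_antisymm _ a₂ (-_)] at hJ
  simp only [dotProduct_add, dotProduct_neg, map_neg, LinearMap.neg_apply, dotProduct_zero,
    neg_apply] at hJ
  linarith

theorem isSymplectic_iff_isRegular [T2Space M] (L : A.Adm → ℝ) (hL : IsSmooth L) :
    c.IsSymplectic L ↔ c.IsRegular L := by
  refine ⟨fun h => isRegular_of_nondegenerate hL h.1, fun h =>
    ⟨fun w hw v hv hΩ => h.nondegenerate hL hw hv hΩ, fun σ τ υ hσ hτ hυ _ w hw => ?_⟩⟩
  exact c.dTwo_Ω₀ (c.dom_subset _ hw.1) (hσ.contDiffAt.differentiableAt (by simp))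
    (hτ.contDiffAt.differentiableAt (by simp)) (hυ.contDiffAt.differentiableAt (by simp))

end ConstraintChart
end LieAlgebroid
theorem mainTheorem2 {m n k : ℕ} {M : Type*} [TopologicalSpace M] [T2Space M]
    [ChartedSpace (EuclideanSpace ℝ (Fin m)) M] [IsManifold (𝓡 m) ∞ M] {E : M → Type*}
    [TopologicalSpace (TotalSpace (EuclideanSpace ℝ (Fin n)) E)]
    [∀ x, AddCommGroup (E x)] [∀ x, Module ℝ (E x)] [∀ x, TopologicalSpace (E x)]
    [FiberBundle (EuclideanSpace ℝ (Fin n)) E] [VectorBundle ℝ (EuclideanSpace ℝ (Fin n)) E]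
    [ContMDiffVectorBundle ∞ (EuclideanSpace ℝ (Fin n)) E (𝓡 m)]
    (A : LieAlgebroid (m := m) (n := n) E) (N : A.ConstraintSubmanifold k)
    (L : A.Adm → ℝ) (hL : LieAlgebroid.IsSmooth L) :
    (N.IsSymplecticW₁ L ↔
      ∀ c : LieAlgebroid.ConstraintChart N.carrier k, c.IsRegular L) ∧
    ∀ c : LieAlgebroid.ConstraintChart N.carrier k, c.IsSymplectic L ↔ c.IsRegular L := by
  exact ⟨forall_congr' fun c => c.isSymplectic_iff_isRegular L hL,
    fun c => c.isSymplectic_iff_isRegular L hL⟩
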